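/- Let $A=\mathbb{C}\{s\}$ be the algebra of convergent power series and let $B=\mathbb{C}\{\{b\}\}$ be the algebra of series $S=\sum_q S_q b^q$ with $|S_q|\le C R^q q!$ for some $C$ and some $R>1$. Let $\tilde{\mathcal A}_{conv}$ be the $\mathbb{C}$-algebra of all series $\sum_{p,q\ge 0}x_{p,q}a^pb^q$ with $|x_{p,q}|\le C R^{p+q}q!$ for some $C$ and some $R>1$, with the product given by $ab-ba=b^2$; equivalently, these series are multiplied as operators on power series in $s$, where $a$ is multiplication by $s$ and $b$ is the primitive without constant term. It contains $\mathbb{C}\{a\}\simeq A$ and $B$. A convergent (a,b)-module is a left $\tilde{\mathcal A}_{conv}$-module $\mathcal E$ that is free of finite rank over $B$. It is *simple pole* if $a\mathcal E\subset b\mathcal E$, and *regular* if it embeds in a simple pole one. Let $\mathcal E^\sharp=\sum_{k\ge0}B\,(b^{-1}a)^k\mathcal E\subset\mathcal E[b^{-1}]$ be its saturation (so $\mathcal E^\sharp=\mathcal E$ in the simple pole case). The *Bernstein polynomial* of a regular $\mathcal E$ is the minimal polynomial of $-b^{-1}a$ acting on $\mathcal E^\sharp/b\mathcal E^\sharp$.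 Finally, $\mathcal E$ is *geometric* if it is regular and all roots of its Bernstein polynomial are negative rational numbers. **Theorem.** Let $p\ge1$ and let $M$ be a $p\times p$ matrix with entries in $A$ such that the simple pole differential system $s\,\frac{dF}{ds}=M(s)F$ is geometric, that is, every eigenvalue of $M(0)$ is a positive rational number. Let $\mathcal E$ be the free $B$-module of rank $p$ with basis $e=(e_1,\dots,e_p)$ (written as a column). Then there exists a unique structure of simple pole geometric convergent (a,b)-module on $\mathcal E$, inducing the given $B$-module structure, such that $$ae=M(a)\,b\,e,\qquad\text{i.e. } a e_i=\sum_{j}M_{ij}(a)\,b\,e_j\quad(1\le i\le p).$$ Moreover, for this structure there is a unique $p\times p$ matrix $X$ with entries in $B$ such that $ae=X(b)\,b\,e$; it satisfies $X(0)=M(0)$, and the Bernstein polynomial of $\mathcal E$ is the minimal polynomial of $-M(0)$. -/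

import Mathlib

noncomputable section
namespace ABModule

open Finset PowerSeries
open scoped Nat

theorem memA_fst {n : ℕ} {k : ℕ × ℕ} (h : k ∈ antidiagonal n) : k.1 ≤ n := by
  have := Finset.HasAntidiagonal.mem_antidiagonal.1 h
  omega

theorem memA_snd {n : ℕ} {k : ℕ × ℕ} (h : k ∈ antidiagonal n) : k.2 ≤ n := by
  have := Finset.HasAntidiagonal.mem_antidiagonal.1 h
  omega

/-- The algebra `A = ℂ{s}` of germs at `0` of holomorphic functions of one variable: the power series
with a positive radius of convergence, `|f_n| ≤ C R ^ n`. -/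
def HolA : Subalgebra ℂ ℂ⟦X⟧ where
  carrier := {f | ∃ R : ℝ, 1 < R ∧ ∃ C : ℝ, ∀ n, ‖coeff n f‖ ≤ C * R ^ n}
  mul_mem' := by
    rintro f g ⟨R, hR, C, hf⟩ ⟨S, hS, D, hg⟩
    have hC : 0 ≤ C := by simpa using (norm_nonneg _).trans (hf 0)
    have hD : 0 ≤ D := by simpa using (norm_nonneg _).trans (hg 0)
    refine ⟨2 * (R * S), by nlinarith, C * D, fun n => ?_⟩
    rw [coeff_mul]
    calc ‖∑ p ∈ antidiagonal n, coeff p.1 f * coeff p.2 g‖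
        ≤ ∑ p ∈ antidiagonal n, C * D * (R * S) ^ n := by
          refine norm_sum_le_of_le _ fun p hp => ?_
          rw [norm_mul]
          have h1 : R ^ p.1 ≤ R ^ n :=
            pow_le_pow_right₀ hR.le (memA_fst hp)
          have h2 : S ^ p.2 ≤ S ^ n :=
            pow_le_pow_right₀ hS.le (memA_snd hp)
          calc _ ≤ (C * R ^ p.1) * (D * S ^ p.2) := by gcongr; exacts [hf _, hg _]
            _ ≤ (C * R ^ n) * (D * S ^ n) := by gcongr
            _ = _ := by ring
      _ = (n + 1 : ℝ) * (C * D * (R * S) ^ n) := by simp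
      _ ≤ (2 : ℝ) ^ n * (C * D * (R * S) ^ n) := by
          have : (n + 1 : ℝ) ≤ 2 ^ n := by exact_mod_cast Nat.lt_two_pow_self
          gcongr
      _ = C * D * (2 * (R * S)) ^ n := by rw [mul_pow 2]; ring
  add_mem' := by
    rintro f g ⟨R, hR, C, hf⟩ ⟨S, hS, D, hg⟩
    have hC : 0 ≤ C := by simpa using (norm_nonneg _).trans (hf 0)
    have hD : 0 ≤ D := by simpa using (norm_nonneg _).trans (hg 0)
    refine ⟨R * S, by nlinarith, C + D, fun n => ?_⟩
    have h1 : R ^ n ≤ (R * S) ^ n := pow_le_pow_left₀ (by linarith) (by nlinarith) n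
    have h2 : S ^ n ≤ (R * S) ^ n := pow_le_pow_left₀ (by linarith) (by nlinarith) n
    rw [map_add, add_mul]
    exact (norm_add_le _ _).trans (add_le_add ((hf n).trans (by gcongr)) ((hg n).trans (by gcongr)))
  algebraMap_mem' := by
    intro z
    refine ⟨2, by norm_num, ‖z‖, fun n => ?_⟩
    have h1 : (1 : ℝ) ≤ 2 ^ n := one_le_pow₀ (by norm_num)
    rw [PowerSeries.algebraMap_apply, coeff_C]
    split_ifs
    · simpa using le_mul_of_one_le_right (norm_nonneg z) h1
    · rw [norm_zero]; positivity

theorem fact_add_le {a b n : ℕ} (h : a + b = n) : ((a ! : ℕ) : ℝ) * (b ! : ℕ) ≤ (n ! : ℕ) := by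
  subst h
  exact_mod_cast Nat.le_of_dvd (Nat.factorial_pos _) (Nat.factorial_mul_factorial_dvd_factorial_add a b)

/-- The algebra `B = ℂ{{b}}`: the power series `S = ∑ S_n b ^ n` with `|S_n| ≤ C R ^ n n!`. It acts on
`ℂ{s}` by letting `b` be the primitive without constant term. -/
def GevB : Subalgebra ℂ ℂ⟦X⟧ where
  carrier := {S | ∃ R : ℝ, 1 < R ∧ ∃ C : ℝ, ∀ n, ‖coeff n S‖ ≤ C * R ^ n * n !}
  mul_mem' := by
    rintro f g ⟨R, hR, C, hf⟩ ⟨S, hS, D, hg⟩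
    have hC : 0 ≤ C := by simpa using (norm_nonneg _).trans (hf 0)
    have hD : 0 ≤ D := by simpa using (norm_nonneg _).trans (hg 0)
    refine ⟨2 * (R * S), by nlinarith, C * D, fun n => ?_⟩
    rw [coeff_mul]
    calc ‖∑ p ∈ antidiagonal n, coeff p.1 f * coeff p.2 g‖
        ≤ ∑ p ∈ antidiagonal n, C * D * (R * S) ^ n * n ! := by
          refine norm_sum_le_of_le _ fun p hp => ?_
          rw [norm_mul]
          have h1 : R ^ p.1 ≤ R ^ n :=
            pow_le_pow_right₀ hR.le (memA_fst hp)
          have h2 : S ^ p.2 ≤ S ^ n :=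
            pow_le_pow_right₀ hS.le (memA_snd hp)
          calc _ ≤ (C * R ^ p.1 * p.1 !) * (D * S ^ p.2 * p.2 !) := by
                gcongr; exacts [hf _, hg _]
            _ ≤ (C * R ^ n * p.1 !) * (D * S ^ n * p.2 !) := by gcongr
            _ = C * D * (R * S) ^ n * (p.1 ! * p.2 !) := by rw [mul_pow]; ring
            _ ≤ _ := by gcongr; exact fact_add_le (Finset.HasAntidiagonal.mem_antidiagonal.1 hp)
      _ = (n + 1 : ℝ) * (C * D * (R * S) ^ n * n !) := by simp
      _ ≤ (2 : ℝ) ^ n * (C * D * (R * S) ^ n * n !) := by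
          have : (n + 1 : ℝ) ≤ 2 ^ n := by exact_mod_cast Nat.lt_two_pow_self
          gcongr
      _ = C * D * (2 * (R * S)) ^ n * n ! := by rw [mul_pow 2]; ring
  add_mem' := by
    rintro f g ⟨R, hR, C, hf⟩ ⟨S, hS, D, hg⟩
    have hC : 0 ≤ C := by simpa using (norm_nonneg _).trans (hf 0)
    have hD : 0 ≤ D := by simpa using (norm_nonneg _).trans (hg 0)
    refine ⟨R * S, by nlinarith, C + D, fun n => ?_⟩
    have h1 : R ^ n ≤ (R * S) ^ n := pow_le_pow_left₀ (by linarith) (by nlinarith) n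
    have h2 : S ^ n ≤ (R * S) ^ n := pow_le_pow_left₀ (by linarith) (by nlinarith) n
    rw [map_add, add_mul, add_mul]
    exact (norm_add_le _ _).trans (add_le_add ((hf n).trans (by gcongr)) ((hg n).trans (by gcongr)))
  algebraMap_mem' := by
    intro z
    refine ⟨2, by norm_num, ‖z‖, fun n => ?_⟩
    have h1 : (1 : ℝ) ≤ 2 ^ n := one_le_pow₀ (by norm_num)
    rw [PowerSeries.algebraMap_apply, coeff_C]
    split_ifs with h
    · subst h; simp
    · simp; positivity

/-- The growth condition `|x_{p,q}| ≤ C R ^ (p + q) q!` for some `R > 1` and some `C`. -/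
def Bounded (x : ℕ → ℕ → ℂ) : Prop :=
  ∃ R : ℝ, 1 < R ∧ ∃ C : ℝ, ∀ p q, ‖x p q‖ ≤ C * R ^ (p + q) * q !

/-- The operator `∑ x_{p,q} a ^ p b ^ q` on power series in `s`, where `a` is the multiplication by `s` and
`b` is the primitive without constant, so that `a ^ p b ^ q s ^ r = r! / (q + r)! s ^ (p + q + r)`. -/
def op (x : ℕ → ℕ → ℂ) : Module.End ℂ ℂ⟦X⟧ where
  toFun f := PowerSeries.mk fun m => ∑ k ∈ antidiagonal m, ∑ u ∈ antidiagonal k.1,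
    x u.1 u.2 * ((k.2 ! : ℂ) / ((u.2 + k.2)! : ℂ)) * coeff k.2 f
  map_add' f g := by
    ext m
    simp only [coeff_mk, map_add, mul_add, sum_add_distrib]
  map_smul' c f := by
    ext m
    simp only [coeff_mk, map_smul, smul_eq_mul, RingHom.id_apply, mul_sum]
    exact sum_congr rfl fun _ _ => sum_congr rfl fun _ _ => by ring

theorem coeff_op (x : ℕ → ℕ → ℂ) (f : ℂ⟦X⟧) (m : ℕ) :
    coeff m (op x f) = ∑ k ∈ antidiagonal m, ∑ u ∈ antidiagonal k.1,
      x u.1 u.2 * ((k.2 ! : ℂ) / ((u.2 + k.2)! : ℂ)) * coeff k.2 f := by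
  simp [op]

/-- The integers with `b ^ q a ^ p = ∑ j, reord p q j • a ^ (p - j) b ^ (q + j)`. -/
def reord : ℕ → ℕ → ℕ → ℤ
  | 0, _, 0 => 1
  | 0, _, _ + 1 => 0
  | p + 1, q, 0 => reord p q 0
  | p + 1, q, j + 1 => reord p q (j + 1) - q * reord p (q + 1) j

theorem reord_eq_zero : ∀ (p q j : ℕ), p < j → reord p q j = 0
  | 0, _, 0, h => absurd h (lt_irrefl _)
  | 0, _, _ + 1, _ => by simp [reord]
  | p + 1, q, 0, h => absurd h (by omega)
  | p + 1, q, j + 1, h => by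
      rw [reord, reord_eq_zero p q (j + 1) (by omega), reord_eq_zero p (q + 1) j (by omega)]
      simp

theorem reord_bound : ∀ (p q j : ℕ),
    ‖(reord p q j : ℂ)‖ * q ! ≤ (p.choose j : ℝ) * (q + j)!
  | 0, q, 0 => by simp [reord]
  | 0, q, j + 1 => by simp [reord]
  | p + 1, q, 0 => by simpa [reord] using reord_bound p q 0
  | p + 1, q, j + 1 => by
      have h1 := reord_bound p q (j + 1)
      have h2 := reord_bound p (q + 1) j
      rw [reord, Nat.choose_succ_succ]
      push_cast
      have h3 : ‖(reord p q (j + 1) : ℂ) - q * reord p (q + 1) j‖ ≤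
          ‖(reord p q (j + 1) : ℂ)‖ + (q + 1) * ‖(reord p (q + 1) j : ℂ)‖ := by
        refine (norm_sub_le _ _).trans ?_
        rw [norm_mul, Complex.norm_natCast]
        gcongr
        linarith
      have e : q + 1 + j = q + (j + 1) := by ring
      rw [e, Nat.factorial_succ q] at h2
      push_cast at h2
      calc _ ≤ (‖(reord p q (j + 1) : ℂ)‖ + (q + 1) * ‖(reord p (q + 1) j : ℂ)‖) * q ! := by
            gcongr
        _ ≤ _ := by linarith

theorem reord_id : ∀ (p q n : ℕ), ∑ j ∈ range (p + 1), (reord p q j : ℂ) / ((n + q + j)! : ℂ) =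
    ((n + p)! : ℂ) / ((n ! : ℂ) * ((n + p + q)! : ℂ))
  | 0, q, n => by
      have : (n ! : ℂ) ≠ 0 := by exact_mod_cast Nat.factorial_ne_zero n
      simp [reord]
      field_simp
  | p + 1, q, n => by
      rw [sum_range_succ']
      have h1 := reord_id p q n
      have h2 := reord_id p (q + 1) n
      rw [sum_range_succ'] at h1
      have hz : ∑ j ∈ range p, (reord p q (j + 1) : ℂ) / ((n + q + (j + 1))! : ℂ) =
          ∑ j ∈ range (p + 1), (reord p q (j + 1) : ℂ) / ((n + q + (j + 1))! : ℂ) := by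
        rw [sum_range_succ, reord_eq_zero p q (p + 1) (by omega)]
        simp
      rw [hz] at h1
      have key : ∑ j ∈ range (p + 1), (reord (p + 1) q (j + 1) : ℂ) / ((n + q + (j + 1))! : ℂ) =
          ∑ j ∈ range (p + 1), (reord p q (j + 1) : ℂ) / ((n + q + (j + 1))! : ℂ) -
          q * ∑ j ∈ range (p + 1), (reord p (q + 1) j : ℂ) / ((n + (q + 1) + j)! : ℂ) := by
        rw [mul_sum, ← sum_sub_distrib]
        refine sum_congr rfl fun j _ => ?_
        rw [reord, show n + (q + 1) + j = n + q + (j + 1) by ring]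
        push_cast
        ring
      rw [key, h2, show reord (p + 1) q 0 = reord p q 0 from by rw [reord]]
      have h3 : (∑ j ∈ range (p + 1), (reord p q (j + 1) : ℂ) / ((n + q + (j + 1))! : ℂ)) =
        ((n + p)! : ℂ) / ((n ! : ℂ) * ((n + p + q)! : ℂ)) - reord p q 0 / ((n + q + 0)! : ℂ) := by
        rw [← h1]; ring
      rw [h3, show n + p + (q + 1) = n + p + q + 1 by ring,
        show n + (p + 1) + q = n + p + q + 1 by ring, show n + (p + 1) = n + p + 1 by ring,
        Nat.factorial_succ (n + p + q), Nat.factorial_succ (n + p)]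
      have e1 : (n ! : ℂ) ≠ 0 := by exact_mod_cast Nat.factorial_ne_zero n
      have e2 : ((n + p + q)! : ℂ) ≠ 0 := by exact_mod_cast Nat.factorial_ne_zero _
      have e3 : ((n + p + q + 1 : ℕ) : ℂ) ≠ 0 := by exact_mod_cast Nat.succ_ne_zero (n + p + q)
      push_cast at e3 ⊢
      field_simp
      ring

/-- The coefficients of the product of `∑ x_{p,q} a ^ p b ^ q` and `∑ y_{p,q} a ^ p b ^ q`, computed with
`a b - b a = b ^ 2`. -/
def prodCoeff (x y : ℕ → ℕ → ℂ) (m n : ℕ) : ℂ :=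
  ∑ k ∈ antidiagonal (m + n), ∑ u ∈ antidiagonal k.1, ∑ v ∈ antidiagonal k.2,
    x u.1 u.2 * y v.1 v.2 *
      ∑ j ∈ range (v.1 + 1), if u.2 + v.2 + j = n then (reord v.1 u.2 j : ℂ) else 0

theorem Bounded.prodCoeff {x y : ℕ → ℕ → ℂ} (hx : Bounded x) (hy : Bounded y) :
    Bounded (prodCoeff x y) := by
  obtain ⟨R, hR, C, hx⟩ := hx
  obtain ⟨S, hS, D, hy⟩ := hy
  have hC : 0 ≤ C := by simpa using (norm_nonneg _).trans (hx 0 0)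
  have hD : 0 ≤ D := by simpa using (norm_nonneg _).trans (hy 0 0)
  refine ⟨16 * (R * S), by nlinarith, C * D, fun m n => ?_⟩
  have inner : ∀ k ∈ antidiagonal (m + n), ∀ u ∈ antidiagonal k.1, ∀ v ∈ antidiagonal k.2,
      ‖x u.1 u.2 * y v.1 v.2 *
      ∑ j ∈ range (v.1 + 1), if u.2 + v.2 + j = n then (reord v.1 u.2 j : ℂ) else 0‖ ≤
      C * D * (R * S) ^ (m + n) * 2 ^ (m + n) * n ! := by
    intro k hk u hu v hv
    have hk' := Finset.HasAntidiagonal.mem_antidiagonal.1 hk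
    have hu' := Finset.HasAntidiagonal.mem_antidiagonal.1 hu
    have hv' := Finset.HasAntidiagonal.mem_antidiagonal.1 hv
    have hsum : ‖∑ j ∈ range (v.1 + 1), if u.2 + v.2 + j = n then (reord v.1 u.2 j : ℂ) else 0‖
        * (u.2 ! * v.2 !) ≤ 2 ^ (m + n) * n ! := by
      by_cases hn : u.2 + v.2 ≤ n ∧ n - (u.2 + v.2) < v.1 + 1
      · have e : ∀ j, (u.2 + v.2 + j = n) ↔ (n - (u.2 + v.2) = j) := by intro j; omega
        simp only [e, sum_ite_eq, mem_range, hn.2, if_true]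
        set j := n - (u.2 + v.2) with hj
        have hb := reord_bound v.1 u.2 j
        have hc : ((v.1.choose j : ℕ) : ℝ) ≤ 2 ^ (m + n) := by
          have : v.1.choose j ≤ 2 ^ (m + n) :=
            (Nat.choose_le_two_pow _ _).trans (Nat.pow_le_pow_right (by norm_num) (by omega))
          exact_mod_cast this
        calc _ = (‖(reord v.1 u.2 j : ℂ)‖ * u.2 !) * v.2 ! := by ring
          _ ≤ ((v.1.choose j : ℝ) * (u.2 + j)!) * v.2 ! := by gcongr
          _ = (v.1.choose j : ℝ) * ((u.2 + j)! * v.2 !) := by ring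
          _ ≤ _ := by
            gcongr
            exact fact_add_le (by omega)
      · rw [sum_eq_zero]
        · rw [norm_zero, zero_mul]; positivity
        · intro j hj
          rw [if_neg]
          have := mem_range.1 hj
          omega
    have h1 : R ^ (u.1 + u.2) ≤ R ^ (m + n) := pow_le_pow_right₀ hR.le (by omega)
    have h2 : S ^ (v.1 + v.2) ≤ S ^ (m + n) := pow_le_pow_right₀ hS.le (by omega)
    rw [norm_mul, norm_mul]
    set Z := ‖∑ j ∈ range (v.1 + 1), if u.2 + v.2 + j = n then (reord v.1 u.2 j : ℂ) else 0‖
    calc _ ≤ (C * R ^ (u.1 + u.2) * u.2 !) * (D * S ^ (v.1 + v.2) * v.2 !) * Z := by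
          gcongr; exacts [hx _ _, hy _ _]
      _ ≤ (C * R ^ (m + n) * u.2 !) * (D * S ^ (m + n) * v.2 !) * Z := by gcongr
      _ = C * D * (R * S) ^ (m + n) * (Z * (u.2 ! * v.2 !)) := by rw [mul_pow]; ring
      _ ≤ C * D * (R * S) ^ (m + n) * (2 ^ (m + n) * n !) := by gcongr
      _ = _ := by ring
  set K := C * D * (R * S) ^ (m + n) * 2 ^ (m + n) * n ! with hK
  have hK0 : 0 ≤ K := by positivity
  have hp : ((m + n : ℕ) + 1 : ℝ) ≤ 2 ^ (m + n) := by exact_mod_cast Nat.lt_two_pow_self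
  calc ‖ABModule.prodCoeff x y m n‖ ≤ ∑ k ∈ antidiagonal (m + n),
        ((m + n : ℕ) + 1 : ℝ) * (((m + n : ℕ) + 1 : ℝ) * K) := by
        refine norm_sum_le_of_le _ fun k hk => ?_
        have hk' := Finset.HasAntidiagonal.mem_antidiagonal.1 hk
        calc _ ≤ ∑ u ∈ antidiagonal k.1, ∑ v ∈ antidiagonal k.2, K :=
              norm_sum_le_of_le _ fun u hu => norm_sum_le_of_le _ fun v hv => inner k hk u hu v hv
          _ = ((k.1 : ℝ) + 1) * (((k.2 : ℝ) + 1) * K) := by simp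
          _ ≤ _ := by
            have h1 : (k.1 : ℝ) ≤ (m + n : ℕ) := by exact_mod_cast (by omega : k.1 ≤ m + n)
            have h2 : (k.2 : ℝ) ≤ (m + n : ℕ) := by exact_mod_cast (by omega : k.2 ≤ m + n)
            gcongr
    _ = ((m + n : ℕ) + 1 : ℝ) * (((m + n : ℕ) + 1 : ℝ) * (((m + n : ℕ) + 1 : ℝ) * K)) := by simp
    _ ≤ 2 ^ (m + n) * (2 ^ (m + n) * (2 ^ (m + n) * K)) := by gcongr
    _ = _ := by
      rw [hK, show (16 : ℝ) * (R * S) = 2 * (2 * (2 * (2 * (R * S)))) by ring]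
      simp only [mul_pow]
      ring

theorem op_mul_op (x y : ℕ → ℕ → ℂ) : op x * op y = op (prodCoeff x y) := by
  ext f D
  rw [Module.End.mul_apply, coeff_op, coeff_op]
  -- right hand side
  have hR : ∀ k ∈ antidiagonal D, (∑ w ∈ antidiagonal k.1,
      prodCoeff x y w.1 w.2 * ((k.2 ! : ℂ) / ((w.2 + k.2)! : ℂ)) * coeff k.2 f) =
      ∑ l ∈ antidiagonal k.1, ∑ u ∈ antidiagonal l.1, ∑ v ∈ antidiagonal l.2,
        x u.1 u.2 * (((l.2 + k.2)! : ℂ) / ((u.2 + (l.2 + k.2))! : ℂ)) *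
          (y v.1 v.2 * ((k.2 ! : ℂ) / ((v.2 + k.2)! : ℂ)) * coeff k.2 f) := by
    intro k _
    have : ∀ w ∈ antidiagonal k.1,
        prodCoeff x y w.1 w.2 * ((k.2 ! : ℂ) / ((w.2 + k.2)! : ℂ)) * coeff k.2 f =
        ∑ l ∈ antidiagonal k.1, ∑ u ∈ antidiagonal l.1, ∑ v ∈ antidiagonal l.2,
          x u.1 u.2 * y v.1 v.2 * (∑ j ∈ range (v.1 + 1), if u.2 + v.2 + j = w.2 then
            (reord v.1 u.2 j : ℂ) else 0) * ((k.2 ! : ℂ) / ((w.2 + k.2)! : ℂ)) * coeff k.2 f := by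
      intro w hw
      rw [prodCoeff, Finset.HasAntidiagonal.mem_antidiagonal.1 hw]
      simp only [sum_mul]
    rw [sum_congr rfl this, sum_comm]
    refine sum_congr rfl fun l hl => ?_
    rw [sum_comm]
    refine sum_congr rfl fun u hu => ?_
    rw [sum_comm]
    refine sum_congr rfl fun v hv => ?_
    have hl' := Finset.HasAntidiagonal.mem_antidiagonal.1 hl
    have hu' := Finset.HasAntidiagonal.mem_antidiagonal.1 hu
    have hv' := Finset.HasAntidiagonal.mem_antidiagonal.1 hv
    have e1 : ∀ w : ℕ × ℕ, x u.1 u.2 * y v.1 v.2 *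
        (∑ j ∈ range (v.1 + 1), if u.2 + v.2 + j = w.2 then
            (reord v.1 u.2 j : ℂ) else 0) * ((k.2 ! : ℂ) / ((w.2 + k.2)! : ℂ)) * coeff k.2 f =
        x u.1 u.2 * y v.1 v.2 * k.2 ! * coeff k.2 f * (∑ j ∈ range (v.1 + 1),
          if u.2 + v.2 + j = w.2 then (reord v.1 u.2 j : ℂ) / ((w.2 + k.2)! : ℂ) else 0) := by
      intro w
      have : ∀ j, (if u.2 + v.2 + j = w.2 then (reord v.1 u.2 j : ℂ) / ((w.2 + k.2)! : ℂ) else 0)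
        = (if u.2 + v.2 + j = w.2 then (reord v.1 u.2 j : ℂ) else 0) / ((w.2 + k.2)! : ℂ) := by
        intro j; split_ifs <;> simp
      simp only [this, ← sum_div]
      ring
    simp only [e1, ← mul_sum]
    rw [sum_comm]
    have e2 : ∀ j ∈ range (v.1 + 1), (∑ w ∈ antidiagonal k.1,
        if u.2 + v.2 + j = w.2 then (reord v.1 u.2 j : ℂ) / ((w.2 + k.2)! : ℂ) else 0) =
        (reord v.1 u.2 j : ℂ) / (((v.2 + k.2) + u.2 + j)! : ℂ) := by
      intro j hj
      have hj' := mem_range.1 hj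
      rw [sum_eq_single (k.1 - (u.2 + v.2 + j), u.2 + v.2 + j)]
      · simp only [if_true]
        rw [show u.2 + v.2 + j + k.2 = v.2 + k.2 + u.2 + j by ring]
      · rintro ⟨w1, w2⟩ hw hne
        rw [if_neg]
        rintro h
        apply hne
        have := Finset.HasAntidiagonal.mem_antidiagonal.1 hw
        simp only at this h
        ext <;> simp only <;> omega
      · intro h
        exact absurd (Finset.HasAntidiagonal.mem_antidiagonal.2 (by simp only; omega)) h
    rw [sum_congr rfl e2, reord_id, show v.2 + k.2 + v.1 = l.2 + k.2 by omega,
      show u.2 + (l.2 + k.2) = l.2 + k.2 + u.2 by ring]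
    ring
  rw [sum_congr rfl hR]
  -- left hand side
  simp only [coeff_op, mul_sum]
  have hL : ∀ k ∈ antidiagonal D, (∑ u ∈ antidiagonal k.1, ∑ l ∈ antidiagonal k.2,
      ∑ v ∈ antidiagonal l.1, x u.1 u.2 * ((k.2 ! : ℂ) / ((u.2 + k.2)! : ℂ)) *
        (y v.1 v.2 * ((l.2 ! : ℂ) / ((v.2 + l.2)! : ℂ)) * coeff l.2 f)) =
      ∑ l ∈ antidiagonal k.2, ∑ u ∈ antidiagonal k.1,
      ∑ v ∈ antidiagonal l.1, x u.1 u.2 * (((l.1 + l.2)! : ℂ) / ((u.2 + (l.1 + l.2))! : ℂ)) *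
        (y v.1 v.2 * ((l.2 ! : ℂ) / ((v.2 + l.2)! : ℂ)) * coeff l.2 f) := by
    intro k hk
    rw [sum_comm]
    refine sum_congr rfl fun l hl => ?_
    rw [Finset.HasAntidiagonal.mem_antidiagonal.1 hl]
  rw [sum_congr rfl hL]
  refine (sum_sigma' _ _ _).trans (Eq.trans ?_ (sum_sigma' _ _ _).symm)
  refine sum_nbij' (fun z => ⟨(z.1.1 + z.2.1, z.2.2), (z.1.1, z.2.1)⟩ :
      (Σ _ : ℕ × ℕ, ℕ × ℕ) → (Σ _ : ℕ × ℕ, ℕ × ℕ))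
    (fun z => ⟨(z.2.1, z.2.2 + z.1.2), (z.2.2, z.1.2)⟩) ?_ ?_ ?_ ?_ ?_ <;>
    simp +contextual [mem_sigma, Finset.HasAntidiagonal.mem_antidiagonal] <;> grind

theorem op_add_op (x y : ℕ → ℕ → ℂ) : op x + op y = op (x + y) := by
  ext f m
  simp only [LinearMap.add_apply, map_add, coeff_op, Pi.add_apply, add_mul, sum_add_distrib]

theorem Bounded.add {x y : ℕ → ℕ → ℂ} (hx : Bounded x) (hy : Bounded y) : Bounded (x + y) := by
  obtain ⟨R, hR, C, hx⟩ := hx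
  obtain ⟨S, hS, D, hy⟩ := hy
  have hC : 0 ≤ C := by simpa using (norm_nonneg _).trans (hx 0 0)
  have hD : 0 ≤ D := by simpa using (norm_nonneg _).trans (hy 0 0)
  refine ⟨R * S, by nlinarith, C + D, fun p q => ?_⟩
  have h1 : R ^ (p + q) ≤ (R * S) ^ (p + q) :=
    pow_le_pow_left₀ (by linarith) (by nlinarith) _
  have h2 : S ^ (p + q) ≤ (R * S) ^ (p + q) :=
    pow_le_pow_left₀ (by linarith) (by nlinarith) _
  rw [add_mul, add_mul]
  exact (norm_add_le _ _).trans
    (add_le_add ((hx p q).trans (by gcongr)) ((hy p q).trans (by gcongr)))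

/-- The series `f(a)`, for `f` a power series. -/
def fromA (f : ℂ⟦X⟧) : ℕ → ℕ → ℂ := fun p q => if q = 0 then coeff p f else 0
/-- The series `S(b)`, for `S` a power series. -/
def fromB (S : ℂ⟦X⟧) : ℕ → ℕ → ℂ := fun p q => if p = 0 then coeff q S else 0

theorem op_fromA (f g : ℂ⟦X⟧) : op (fromA f) g = f * g := by
  ext m
  rw [coeff_op, coeff_mul]
  refine sum_congr rfl fun k _ => ?_
  rw [sum_eq_single (k.1, 0)]
  · have : (k.2 ! : ℂ) ≠ 0 := by exact_mod_cast Nat.factorial_ne_zero _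
    simp [fromA, this]
  · rintro ⟨u1, u2⟩ hu hne
    have : u2 ≠ 0 := by
      rintro rfl
      exact hne (by simpa using Finset.HasAntidiagonal.mem_antidiagonal.1 hu)
    simp [fromA, this]
  · intro h
    exact absurd (Finset.HasAntidiagonal.mem_antidiagonal.2 (by simp)) h

theorem coeff_op_fromB (S g : ℂ⟦X⟧) (m : ℕ) :
    coeff m (op (fromB S) g) =
      ∑ k ∈ antidiagonal m, coeff k.1 S * ((k.2 ! : ℂ) / (m ! : ℂ)) * coeff k.2 g := by
  rw [coeff_op]
  refine sum_congr rfl fun k hk => ?_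
  rw [sum_eq_single (0, k.1)]
  · simp [fromB, Finset.HasAntidiagonal.mem_antidiagonal.1 hk]
  · rintro ⟨u1, u2⟩ hu hne
    have : u1 ≠ 0 := by
      rintro rfl
      exact hne (by simpa using Finset.HasAntidiagonal.mem_antidiagonal.1 hu)
    simp [fromB, this]
  · intro h
    exact absurd (Finset.HasAntidiagonal.mem_antidiagonal.2 (by simp)) h

theorem bounded_fromA {f : ℂ⟦X⟧} (hf : f ∈ HolA) : Bounded (fromA f) := by
  obtain ⟨R, hR, C, hf⟩ := hf
  refine ⟨R, hR, C, fun p q => ?_⟩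
  have hC : 0 ≤ C := by simpa using (norm_nonneg _).trans (hf 0)
  unfold fromA
  split_ifs with h
  · subst h; simpa using hf p
  · simp; positivity

theorem bounded_fromB {f : ℂ⟦X⟧} (hf : f ∈ GevB) : Bounded (fromB f) := by
  obtain ⟨R, hR, C, hf⟩ := hf
  refine ⟨R, hR, C, fun p q => ?_⟩
  have hC : 0 ≤ C := by simpa using (norm_nonneg _).trans (hf 0)
  unfold fromB
  split_ifs with h
  · subst h; simpa using hf q
  · simp; positivity

/-- A series `∑ x_{p,q} a ^ p b ^ q` is determined by the operator it defines, so that `ConvAB` below is the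
algebra of the series of this form that satisfy the growth condition `Bounded`. -/
theorem op_injective : Function.Injective op := by
  suffices h : ∀ x, op x = 0 → x = 0 by
    intro x y hxy
    have e : op (x - y) + op y = op x := by rw [op_add_op, sub_add_cancel]
    rw [hxy] at e
    exact sub_eq_zero.1 (h _ (by simpa using e))
  intro x hx
  have key : ∀ d r : ℕ, ∑ u ∈ antidiagonal d, x u.1 u.2 * ((r ! : ℂ) / ((u.2 + r)! : ℂ)) = 0 := by
    intro d r
    have h := congrArg (fun T => coeff (d + r) (T (X ^ r : ℂ⟦X⟧))) hx
    simp only [coeff_op, LinearMap.zero_apply, map_zero] at h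
    rw [sum_eq_single (d, r)] at h
    · simpa [coeff_X_pow] using h
    · rintro ⟨k1, k2⟩ hk hne
      have : k2 ≠ r := by
        rintro rfl
        exact hne (by simpa using Finset.HasAntidiagonal.mem_antidiagonal.1 hk)
      simp [coeff_X_pow, this]
    · intro h
      exact absurd (Finset.HasAntidiagonal.mem_antidiagonal.2 (by simp)) h
  have main : ∀ q p, x p q = 0 := by
    intro q
    induction q using Nat.strong_induction_on with
    | _ q ih =>
    intro p
    -- multiply by `(q + r)! / r!` and let `r` tend to infinity
    have hlim : ∀ u ∈ antidiagonal (p + q), Filter.Tendsto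
        (fun r : ℕ => x u.1 u.2 * (((q + r)! : ℂ) / ((u.2 + r)! : ℂ))) Filter.atTop
        (nhds (if u = (p, q) then x p q else 0)) := by
      rintro ⟨u1, u2⟩ hu
      have hu' := Finset.HasAntidiagonal.mem_antidiagonal.1 hu
      simp only at hu' ⊢
      rcases lt_trichotomy u2 q with h | h | h
      · rw [if_neg (by simp; omega)]
        simp [ih u2 h]
      · subst h
        have : u1 = p := by omega
        subst this
        have e : ∀ r : ℕ, (((u2 + r)! : ℂ) / ((u2 + r)! : ℂ)) = 1 := fun r =>
          div_self (by exact_mod_cast Nat.factorial_ne_zero _)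
        simp [e]
      · rw [if_neg (by simp; omega), ← mul_zero (x u1 u2)]
        refine Filter.Tendsto.const_mul _ ?_
        refine squeeze_zero_norm (a := fun r : ℕ => 1 / ((r : ℝ) + 1)) (fun r => ?_)
          tendsto_one_div_add_atTop_nhds_zero_nat
        rw [norm_div, Complex.norm_natCast, Complex.norm_natCast,
          div_le_div_iff₀ (by exact_mod_cast Nat.factorial_pos _) (by positivity)]
        have h1 : (q + r + 1)! ≤ (u2 + r)! := Nat.factorial_le (by omega)
        have h2 : (q + r)! * (r + 1) ≤ (u2 + r)! := by
          refine le_trans ?_ h1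
          rw [Nat.factorial_succ, mul_comm]
          gcongr
          omega
        rw [one_mul]
        exact_mod_cast h2
    have hs := tendsto_finsetSum _ hlim
    rw [sum_ite_eq' (antidiagonal (p + q)) (p, q),
      if_pos (Finset.HasAntidiagonal.mem_antidiagonal.2 (by simp))] at hs
    have hz : (fun r : ℕ => ∑ u ∈ antidiagonal (p + q),
        x u.1 u.2 * (((q + r)! : ℂ) / ((u.2 + r)! : ℂ))) = fun _ => 0 := by
      funext r
      have := congrArg (fun z => z * (((q + r)! : ℂ) / (r ! : ℂ))) (key (p + q) r)
      simp only [zero_mul, sum_mul] at this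
      rw [← this]
      refine sum_congr rfl fun u _ => ?_
      have : (r ! : ℂ) ≠ 0 := by exact_mod_cast Nat.factorial_ne_zero _
      field_simp
    rw [hz] at hs
    exact (tendsto_nhds_unique hs tendsto_const_nhds)
  funext p q
  exact main q p


/-- The convergent algebra: all the series `∑ x_{p,q} a ^ p b ^ q` with `|x_{p,q}| ≤ C R ^ (p + q) q!` for
some `R > 1` and some `C`, multiplied with `a b - b a = b ^ 2`, that is, as operators on power series in `s`. -/
def ConvAB : Subalgebra ℂ (Module.End ℂ ℂ⟦X⟧) where
  carrier := {T | ∃ x, Bounded x ∧ T = op x}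
  mul_mem' := by
    rintro _ _ ⟨x, hx, rfl⟩ ⟨y, hy, rfl⟩
    exact ⟨_, hx.prodCoeff hy, op_mul_op x y⟩
  add_mem' := by
    rintro _ _ ⟨x, hx, rfl⟩ ⟨y, hy, rfl⟩
    exact ⟨_, hx.add hy, op_add_op x y⟩
  algebraMap_mem' := by
    intro z
    refine ⟨_, bounded_fromA (HolA.algebraMap_mem z), ?_⟩
    refine LinearMap.ext fun g => ?_
    rw [op_fromA, Module.algebraMap_end_apply, Algebra.smul_def]

/-- The element `f(a)` of the convergent algebra, for `f` in `A`. -/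
def ofA (f : HolA) : ConvAB := ⟨op (fromA f), _, bounded_fromA f.2, rfl⟩

/-- The element `S(b)` of the convergent algebra, for `S` in `B`. -/
def ofB (S : GevB) : ConvAB := ⟨op (fromB S), _, bounded_fromB S.2, rfl⟩

theorem X_mem_HolA : (X : ℂ⟦X⟧) ∈ HolA := by
  refine ⟨2, by norm_num, 1, fun n => ?_⟩
  rw [coeff_X]
  split_ifs
  · simpa using one_le_pow₀ (by norm_num : (1 : ℝ) ≤ 2)
  · simp

theorem X_mem_GevB : (X : ℂ⟦X⟧) ∈ GevB := by
  refine ⟨2, by norm_num, 1, fun n => ?_⟩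
  rw [coeff_X]
  split_ifs with h
  · subst h; simp
  · rw [norm_zero]; positivity

/-- The generator `b` of `B`. -/
def b : GevB := ⟨X, X_mem_GevB⟩

/-- The element `a` of the convergent algebra. -/
def aOp : ConvAB := ofA ⟨X, X_mem_HolA⟩

/-- The element `b` of the convergent algebra. -/
def bOp : ConvAB := ofB b

theorem aOp_apply (f : ℂ⟦X⟧) : (aOp : Module.End ℂ ℂ⟦X⟧) f = X * f := op_fromA _ _

theorem coeff_zero_bOp_apply (f : ℂ⟦X⟧) : coeff 0 ((bOp : Module.End ℂ ℂ⟦X⟧) f) = 0 := by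
  have h : coeff 0 (op (fromB X) f) = 0 := by simp [coeff_op_fromB]
  exact h

theorem coeff_bOp_apply (f : ℂ⟦X⟧) (n : ℕ) :
    coeff (n + 1) ((bOp : Module.End ℂ ℂ⟦X⟧) f) = coeff n f / ((n : ℂ) + 1) := by
  have h : coeff (n + 1) (op (fromB X) f) = coeff n f / ((n : ℂ) + 1) := by
    rw [coeff_op_fromB, sum_eq_single (1, n)]
    · have h1 : (n ! : ℂ) ≠ 0 := by exact_mod_cast Nat.factorial_ne_zero n
      have h2 : (n : ℂ) + 1 ≠ 0 := by exact_mod_cast Nat.succ_ne_zero n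
      simp only [coeff_one_X, one_mul]
      rw [Nat.factorial_succ]
      push_cast
      field_simp
    · rintro ⟨k1, k2⟩ hk hne
      have : k1 ≠ 1 := by
        rintro rfl
        have := Finset.HasAntidiagonal.mem_antidiagonal.1 hk
        apply hne
        ext <;> simp only at this ⊢
        omega
      simp [coeff_X, this]
    · intro h
      exact absurd (Finset.HasAntidiagonal.mem_antidiagonal.2 (by ring)) h
  exact h

/-- The derivation `S ↦ b S'(b)` of `B`. -/
def theta (S : GevB) : GevB := ⟨PowerSeries.mk fun n => (n : ℂ) * coeff n (S : ℂ⟦X⟧), by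
  obtain ⟨R, hR, C, hS⟩ := S.2
  have hC : 0 ≤ C := by simpa using (norm_nonneg _).trans (hS 0)
  refine ⟨2 * R, by linarith, C, fun n => ?_⟩
  have h : (n : ℝ) ≤ 2 ^ n := by exact_mod_cast Nat.lt_two_pow_self.le
  rw [coeff_mk, norm_mul, Complex.norm_natCast]
  calc (n : ℝ) * ‖coeff n (S : ℂ⟦X⟧)‖ ≤ 2 ^ n * (C * R ^ n * n !) := by gcongr; exact hS n
    _ = C * (2 * R) ^ n * n ! := by rw [mul_pow]; ring⟩

theorem theta_add (S S' : GevB) : theta (S + S') = theta S + theta S' := by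
  apply Subtype.ext
  ext n
  simp [theta, mul_add]

theorem theta_mul (S S' : GevB) : theta (S * S') = theta S * S' + S * theta S' := by
  apply Subtype.ext
  ext n
  simp only [theta, MulMemClass.coe_mul, AddMemClass.coe_add, map_add, coeff_mul, coeff_mk,
    mul_sum, ← sum_add_distrib]
  refine sum_congr rfl fun k hk => ?_
  rw [← Finset.HasAntidiagonal.mem_antidiagonal.1 hk]
  push_cast
  ring

theorem aOp_mul_ofB (S : GevB) : aOp * ofB S = ofB S * aOp + ofB (b * theta S) := by
  apply Subtype.ext
  refine LinearMap.ext fun f => ?_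
  change (op (fromA X)) (op (fromB S) f) =
    op (fromB S) (op (fromA X) f) + op (fromB (X * (theta S : ℂ⟦X⟧))) f
  rw [op_fromA, op_fromA]
  ext m
  rw [map_add, coeff_op_fromB, coeff_op_fromB]
  cases m with
  | zero => simp
  | succ m =>
    rw [coeff_succ_X_mul, coeff_op_fromB, Finset.Nat.sum_antidiagonal_succ',
      Finset.Nat.sum_antidiagonal_succ]
    simp only [coeff_zero_X_mul, coeff_succ_X_mul, mul_zero, zero_mul, zero_add,
      ← sum_add_distrib]
    refine sum_congr rfl fun k hk => ?_
    have hk' := Finset.HasAntidiagonal.mem_antidiagonal.1 hk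
    subst hk'
    simp only [theta, coeff_mk]
    rw [Nat.factorial_succ k.2, Nat.factorial_succ (k.1 + k.2)]
    have h1 : ((k.1 + k.2)! : ℂ) ≠ 0 := by exact_mod_cast Nat.factorial_ne_zero _
    have h2 : ((k.1 : ℂ) + k.2 + 1) ≠ 0 := by exact_mod_cast Nat.succ_ne_zero (k.1 + k.2)
    push_cast
    field_simp
    ring

/-- A structure of convergent (a,b)-module on the free `B`-module `B ^ p`: a structure of left module
over the convergent algebra that induces the given structure of `B`-module. -/
@[ext]
structure GBM (p : ℕ) where
  act : ConvAB →ₐ[ℂ] Module.End ℂ (Fin p → GevB)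
  act_ofB : ∀ (S : GevB) (x : Fin p → GevB), act (ofB S) x = S • x

namespace GBM

variable {p : ℕ} (E : GBM p)

theorem act_a_smul (S : GevB) (x : Fin p → GevB) :
    E.act aOp (S • x) = S • E.act aOp x + (b * theta S) • x := by
  have h := congrArg (fun T => E.act T x) (aOp_mul_ofB S)
  simpa [E.act_ofB] using h

/-- Simple pole: `a E ⊆ b E`. -/
def IsSimplePole : Prop :=
  ∀ x, ∃ y, E.act aOp x = E.act bOp y

/-- Regular: contained in a simple pole convergent (a,b)-module `W` (of finite rank `q` over `B`). -/
def IsRegular : Prop :=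
  ∃ (q : ℕ) (W : GBM q), W.IsSimplePole ∧
    ∃ j : (Fin p → GevB) →+ (Fin q → GevB), Function.Injective j ∧
      ∀ T x, j (E.act T x) = W.act T (j x)

/-- The localization `E[1/b]` of `E = B ^ p`. -/
def Loc (p : ℕ) : Type := LocalizedModule (Submonoid.powers b) (Fin p → GevB)

instance (p : ℕ) : AddCommGroup (Loc p) :=
  inferInstanceAs (AddCommGroup (LocalizedModule (Submonoid.powers b) (Fin p → GevB)))

instance (p : ℕ) : Module GevB (Loc p) :=
  inferInstanceAs (Module GevB (LocalizedModule (Submonoid.powers b) (Fin p → GevB)))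

instance (p : ℕ) : Module ℂ (Loc p) := Module.compHom (Loc p) (algebraMap ℂ GevB)

instance (p : ℕ) : IsScalarTower ℂ GevB (Loc p) where
  smul_assoc c S y := by
    rw [Algebra.smul_def, mul_smul]
    rfl

/-- The fraction `x / s`, where `s` is a power of `b`. -/
def Loc.mk (x : Fin p → GevB) (s : Submonoid.powers b) : Loc p := LocalizedModule.mk x s

theorem Loc.mk_eq {x x' : Fin p → GevB} {s s' : Submonoid.powers b} :
    Loc.mk x s = Loc.mk x' s' ↔
      ∃ u : Submonoid.powers b, (u : GevB) • (s' : GevB) • x = (u : GevB) • (s : GevB) • x' :=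
  LocalizedModule.mk_eq

theorem Loc.mk_surj (y : Loc p) : ∃ x s, y = Loc.mk x s := by
  induction y using LocalizedModule.induction_on with
  | h x s => exact ⟨x, s, rfl⟩

theorem Loc.mk_add (x x' : Fin p → GevB) (s s' : Submonoid.powers b) :
    Loc.mk x s + Loc.mk x' s' = Loc.mk ((s' : GevB) • x + (s : GevB) • x') (s * s') :=
  LocalizedModule.mk_add_mk

theorem Loc.smul_mk (S : GevB) (x : Fin p → GevB) (s : Submonoid.powers b) :
    S • Loc.mk x s = Loc.mk (S • x) s :=
  LocalizedModule.smul'_mk S x s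

theorem Loc.csmul (c : ℂ) (y : Loc p) : c • y = algebraMap ℂ GevB c • y := rfl

/-- The element `b` of the multiplicative set of its powers. -/
def bS : Submonoid.powers b := ⟨b, Submonoid.mem_powers b⟩

theorem theta_algebraMap (c : ℂ) : theta (algebraMap ℂ GevB c) = 0 := by
  apply Subtype.ext
  ext n
  change coeff n (PowerSeries.mk fun n => (n : ℂ) * coeff n (algebraMap ℂ ℂ⟦X⟧ c)) = 0
  rw [coeff_mk, PowerSeries.algebraMap_apply, coeff_C]
  split_ifs with h
  · subst h; simp
  · simp

theorem invBA_wd (x x' : Fin p → GevB) (s s' : Submonoid.powers b)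
    (h : ∃ u : Submonoid.powers b, (u : GevB) • (s' : GevB) • x = (u : GevB) • (s : GevB) • x') :
    Loc.mk ((s : GevB) • E.act aOp x - (b * theta s) • x) (bS * s ^ 2) =
    Loc.mk ((s' : GevB) • E.act aOp x' - (b * theta s') • x') (bS * s' ^ 2) := by
  obtain ⟨u, hu⟩ := h
  rw [Loc.mk_eq]
  refine ⟨u ^ 2, ?_⟩
  have h1 := congrArg (fun z => (u : GevB) • E.act aOp z) hu
  simp only [act_a_smul] at h1
  have e : ∀ v : Submonoid.powers b, ((bS * v ^ 2 : Submonoid.powers b) : GevB) = b * (v : GevB) ^ 2 :=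
    fun _ => rfl
  have e' : ((u ^ 2 : Submonoid.powers b) : GevB) = (u : GevB) ^ 2 := rfl
  rw [e, e, e']
  generalize E.act aOp x = ax at *
  generalize E.act aOp x' = ax' at *
  funext i
  have h2 := congrFun h1 i
  have h3 := congrFun hu i
  simp only [Pi.smul_apply, Pi.add_apply, Pi.sub_apply, smul_eq_mul] at h2 h3 ⊢
  generalize x i = xi at *
  generalize x' i = xi' at *
  generalize ax i = axi at *
  generalize ax' i = axi' at *
  generalize theta s = ts at *
  generalize theta s' = ts' at *
  generalize theta u = tu at *
  generalize (s : GevB) = s at *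
  generalize (s' : GevB) = s' at *
  generalize (u : GevB) = u at *
  linear_combination b * s * s' * h2 - (b ^ 2 * s * s' * tu + u * b^2 * s * ts' + u * b^2 * s' * ts) * h3

/-- The action of `b⁻¹ a` on `E[1/b]`. As `a s = s a + b θ(s)` for `s` in `B`, where `θ(s) = b s'(b)`, one has
`b⁻¹ a (x / s) = (s a x - b θ(s) x) / (b s ^ 2)`. -/
def invBAFun (y : Loc p) : Loc p :=
  LocalizedModule.liftOn y (fun z => Loc.mk
      ((z.2 : GevB) • E.act aOp z.1 - (b * theta z.2) • z.1) (bS * z.2 ^ 2))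
    fun z z' h => E.invBA_wd z.1 z'.1 z.2 z'.2 h

theorem invBAFun_mk (x : Fin p → GevB) (s : Submonoid.powers b) :
    E.invBAFun (Loc.mk x s) =
      Loc.mk ((s : GevB) • E.act aOp x - (b * theta s) • x) (bS * s ^ 2) := rfl

theorem invBAFun_add (y y' : Loc p) : E.invBAFun (y + y') = E.invBAFun y + E.invBAFun y' := by
  obtain ⟨x, s, rfl⟩ := Loc.mk_surj y
  obtain ⟨x', s', rfl⟩ := Loc.mk_surj y'
  rw [Loc.mk_add, invBAFun_mk, invBAFun_mk, invBAFun_mk, Loc.mk_add, Loc.mk_eq]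
  refine ⟨1, ?_⟩
  have e : ∀ v : Submonoid.powers b, ((bS * v ^ 2 : Submonoid.powers b) : GevB) = b * (v : GevB) ^ 2 :=
    fun _ => rfl
  have e' : ∀ v w : Submonoid.powers b, ((v * w : Submonoid.powers b) : GevB) = v * (w : GevB) :=
    fun _ _ => rfl
  rw [map_add, act_a_smul, act_a_smul, e' (bS * s ^ 2), e, e, e, e', theta_mul]
  generalize E.act aOp x = ax
  generalize E.act aOp x' = ax'
  funext i
  simp only [Pi.smul_apply, Pi.add_apply, Pi.sub_apply, smul_eq_mul]
  ring

theorem invBAFun_smul (S : GevB) (y : Loc p) :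
    E.invBAFun (S • y) = S • E.invBAFun y + theta S • y := by
  obtain ⟨x, s, rfl⟩ := Loc.mk_surj y
  rw [Loc.smul_mk, Loc.smul_mk, invBAFun_mk, invBAFun_mk, Loc.smul_mk, Loc.mk_add, Loc.mk_eq]
  refine ⟨1, ?_⟩
  have e : ∀ v : Submonoid.powers b, ((bS * v ^ 2 : Submonoid.powers b) : GevB) = b * (v : GevB) ^ 2 :=
    fun _ => rfl
  have e' : ∀ v w : Submonoid.powers b, ((v * w : Submonoid.powers b) : GevB) = v * (w : GevB) :=
    fun _ _ => rfl
  rw [act_a_smul, e' (bS * s ^ 2), e]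
  generalize E.act aOp x = ax
  funext i
  simp only [Pi.smul_apply, Pi.add_apply, Pi.sub_apply, smul_eq_mul]
  ring

/-- The action of `b⁻¹ a` on `E[1/b]`, as a linear map. -/
def invBA : Module.End ℂ (Loc p) where
  toFun := E.invBAFun
  map_add' := E.invBAFun_add
  map_smul' c y := by
    rw [RingHom.id_apply, Loc.csmul, invBAFun_smul, theta_algebraMap, zero_smul, add_zero,
      Loc.csmul]

theorem invBA_mk (x : Fin p → GevB) (s : Submonoid.powers b) :
    E.invBA (Loc.mk x s) =
      Loc.mk ((s : GevB) • E.act aOp x - (b * theta s) • x) (bS * s ^ 2) := rfl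

theorem invBA_smul (S : GevB) (y : Loc p) :
    E.invBA (S • y) = S • E.invBA y + theta S • y :=
  E.invBAFun_smul S y

/-- The saturation of `E` by `b⁻¹ a`: the `B`-submodule of `E[1/b]` generated by all `(b⁻¹ a) ^ k E`. -/
def saturation : Submodule GevB (Loc p) :=
  Submodule.span GevB {y | ∃ (k : ℕ) (x : Fin p → GevB), y = (E.invBA ^ k) (Loc.mk x 1)}

theorem invBA_mem {y : Loc p} (hy : y ∈ E.saturation) : E.invBA y ∈ E.saturation := by
  induction hy using Submodule.span_induction with
  | mem y hy =>
    obtain ⟨k, x, rfl⟩ := hy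
    exact Submodule.subset_span ⟨k + 1, x, by rw [pow_succ']; rfl⟩
  | zero => rw [map_zero]; exact zero_mem _
  | add y z _ _ h1 h2 => rw [map_add]; exact add_mem h1 h2
  | smul S y hy h =>
    rw [invBA_smul]
    exact add_mem (Submodule.smul_mem _ _ h) (Submodule.smul_mem _ _ hy)

instance : AddCommGroup E.saturation := Submodule.addCommGroup E.saturation

instance : Module ℂ E.saturation := Submodule.module' E.saturation

/-- The action of `b⁻¹ a` on the saturation. -/
def satInvBA : Module.End ℂ E.saturation where
  toFun y := ⟨E.invBA y, E.invBA_mem y.2⟩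
  map_add' y y' := Subtype.ext (map_add E.invBA (y : Loc p) y')
  map_smul' c y := Subtype.ext (map_smul E.invBA c (y : Loc p))

/-- `b` times the saturation. -/
def bSat : Submodule ℂ E.saturation where
  carrier := {y | ∃ z : E.saturation, y = b • z}
  add_mem' := by
    rintro _ _ ⟨z, rfl⟩ ⟨z', rfl⟩
    exact ⟨z + z', (smul_add _ _ _).symm⟩
  zero_mem' := ⟨0, (smul_zero _).symm⟩
  smul_mem' := by
    rintro c _ ⟨z, rfl⟩
    exact ⟨c • z, (smul_comm b c z).symm⟩

theorem satInvBA_mem : E.bSat ≤ E.bSat.comap (-E.satInvBA) := by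
  rintro _ ⟨z, rfl⟩
  refine ⟨-(E.satInvBA z + z), Subtype.ext ?_⟩
  change -(E.invBA (b • (z : Loc p))) = b • -(E.invBA (z : Loc p) + z)
  have h : theta b = b := by
    apply Subtype.ext
    ext n
    change coeff n (PowerSeries.mk fun n => (n : ℂ) * coeff n (X : ℂ⟦X⟧)) = coeff n X
    rw [coeff_mk, coeff_X]
    split_ifs with h
    · subst h; simp
    · simp
  rw [invBA_smul, h, smul_neg, smul_add]

/-- The Bernstein polynomial: the minimal polynomial of `-b⁻¹ a` on the quotient of the saturation by `b`
times the saturation. -/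
def bernstein : Polynomial ℂ :=
  minpoly ℂ (E.bSat.mapQ E.bSat (-E.satInvBA) E.satInvBA_mem)

/-- Geometric: regular, with all the roots of the Bernstein polynomial rational and negative. -/
def IsGeometric : Prop :=
  E.IsRegular ∧ ∀ z : ℂ, E.bernstein.IsRoot z → ∃ q : ℚ, q < 0 ∧ z = (q : ℂ)

/-- The relation `a e = M(a) b e`, for the standard basis `e` of `B ^ p` and a matrix `M` over `A`. -/
def HasHolMatrix (M : Matrix (Fin p) (Fin p) HolA) : Prop :=
  ∀ i, E.act aOp (Pi.single i 1) = ∑ j, E.act (ofA (M i j)) (E.act bOp (Pi.single j 1))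

/-- The relation `a e = Y(b) b e`, for the standard basis `e` of `B ^ p` and a matrix `Y` over `B`. -/
def HasGevMatrix (Y : Matrix (Fin p) (Fin p) GevB) : Prop :=
  ∀ i, E.act aOp (Pi.single i 1) = ∑ j, Y i j • E.act bOp (Pi.single j 1)

end GBM

/-- The value `M(0)` of a matrix over `A`. -/
def holAtZero {p : ℕ} (M : Matrix (Fin p) (Fin p) HolA) : Matrix (Fin p) (Fin p) ℂ :=
  M.map fun f => constantCoeff (f : ℂ⟦X⟧)

/-- The value `Y(0)` of a matrix over `B`. -/
def gevAtZero {p : ℕ} (Y : Matrix (Fin p) (Fin p) GevB) : Matrix (Fin p) (Fin p) ℂ :=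
  Y.map fun S => constantCoeff (S : ℂ⟦X⟧)

/-- The simple pole differential system `s dF/ds = M(s) F` is geometric: every eigenvalue of `M(0)` is a
positive rational number. -/
def IsGeometricSystem {p : ℕ} (M : Matrix (Fin p) (Fin p) HolA) : Prop :=
  ∀ z ∈ spectrum ℂ (holAtZero M), ∃ q : ℚ, 0 < q ∧ z = (q : ℂ)

end ABModule

end

noncomputable section
namespace ABModule

open Finset PowerSeries
open scoped Nat

/-! ### Normal ordering in an algebra where `α β - β α = β ^ 2`. -/

section Algebra

variable {W : Type*} [Ring W] [Algebra ℂ W] {α β : W}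

/-! The module is realized on convergent power series with values in `ℂ ^ p`. Write `D = s d/ds +
L(s)`, where `L_n` is right multiplication of row vectors by the coefficient of `s ^ n` in `M`.
Since no eigenvalue of `M(0)` is of the form `-n`, every `n + M(0)` is invertible and `D` is
bijective on formal series. Let `a` be multiplication by `s` and `b = s D⁻¹`. The identity `D (s h)
= s D h + s h` gives `a b - b a = b ^ 2` (`SimplePoleSystem.comm_rel`). Both operators raise the
order in `s`, so every series in `a` and `b` acts on formal series, and the product of the
convergent algebra is respected because reordering is a finite identity in each total degree
(`homog_prodCoeff`, `seriesRep`).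

The basis is `e_i = D(constant i-th vector)`. Then `b e_i` is `s` times the constant vector, so `a
e_i = s L(s)(constant)` is exactly `∑ M_ij(a) b e_j`. Each formal series is uniquely `∑ b ^ q
e(x_q)` (`expand_injective`, `expand_digits`). What remains is growth. Because `b ^ q g` has order
at least `q`, the inverses of `n + M(0)`, of size `O(1/n)`, accumulate to a factor `1/q!`
(`norm_beta_pow_le`); conversely, extracting `k` coefficients applies `D` `k` times and costs `k!`
(`norm_remainder_le`). Hence `B ^ p` corresponds exactly to the convergent series, which are stable
under the convergent algebra (`isConvergent_rep`); the action is transported along this bijection.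
The simple pole is `s g = b (D g)`.

Uniqueness is `b`-adic. The difference of two operators `a` is `B`-linear, and the relation `a e =
M(a) b e` improves a congruence modulo `b ^ N` to one modulo `b ^ (N + 1)` (`act_aOp_eq`); the
action of `a` then determines that of every series (`ext_of_act_aOp`). Finally `f(a) b y` is `f(0) b
y` modulo `b ^ 2`, so `X(0) = M(0)`, and `-b⁻¹ a` induces on `E / b E` right multiplication by
`-M(0)`, from which the Bernstein polynomial is read. -/

theorem pow_mul_of_comm_rel (h : α * β = β * α + β * β) (q : ℕ) :
    β ^ q * α = α * β ^ q - (q : ℂ) • β ^ (q + 1) := by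
  induction q with
  | zero => simp
  | succ q ih =>
    have e : β * α = α * β - β * β := by rw [h]; abel
    rw [pow_succ, mul_assoc, e, mul_sub, ← mul_assoc, ih, sub_mul, mul_assoc, smul_mul_assoc,
      pow_succ β (q + 1), pow_succ β q]
    push_cast
    rw [add_smul, one_smul]
    simp only [mul_assoc]
    abel

/-- Moving one factor `α` to the left across `β ^ q` leaves `-q β ^ (q + 1)`; this is precisely the
recursion that defines `reord`. Only the commutation relation is used, so the integers are the same
for every pair of operators. -/
theorem pow_mul_pow_eq_sum_reord (h : α * β = β * α + β * β) (p q : ℕ) :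
    β ^ q * α ^ p =
      ∑ j ∈ range (p + 1), (reord p q j : ℂ) • (α ^ (p - j) * β ^ (q + j)) := by
  induction p generalizing q with
  | zero => simp [reord]
  | succ p ih =>
    have e1 : β ^ q * α ^ (p + 1) =
        α * (β ^ q * α ^ p) - (q : ℂ) • (β ^ (q + 1) * α ^ p) := by
      rw [pow_succ', ← mul_assoc, pow_mul_of_comm_rel h, sub_mul, mul_assoc, smul_mul_assoc]
    have e2 : ∑ j ∈ range (p + 1), (reord p q j : ℂ) • (α ^ (p - j + 1) * β ^ (q + j)) =
        ∑ j ∈ range (p + 2), (reord p q j : ℂ) • (α ^ (p + 1 - j) * β ^ (q + j)) := by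
      rw [sum_range_succ _ (p + 1), reord_eq_zero p q (p + 1) (by omega)]
      simp only [Int.cast_zero, zero_smul, add_zero]
      refine sum_congr rfl fun j hj => ?_
      rw [show p - j + 1 = p + 1 - j by have := mem_range.1 hj; omega]
    rw [e1, ih, ih, mul_sum]
    simp only [mul_smul_comm, ← mul_assoc, ← pow_succ']
    rw [e2, sum_range_succ', sum_range_succ' _ (p + 1), smul_sum, add_sub_right_comm,
      ← sum_sub_distrib]
    refine congrArg₂ _ (sum_congr rfl fun j _ => ?_) (by simp [reord])
    rw [show p + 1 - (j + 1) = p - j by omega, show q + 1 + j = q + (j + 1) by ring, reord,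
      smul_smul, ← sub_smul]
    push_cast
    rfl

/-- The part of total degree `d` of the series `∑ x_{p,q} α ^ p β ^ q`. -/
def homog (α β : W) (x : ℕ → ℕ → ℂ) (d : ℕ) : W :=
  ∑ k ∈ antidiagonal d, x k.1 k.2 • (α ^ k.1 * β ^ k.2)

/-- Reordering preserves the total degree, so the product rule of the convergent algebra holds
degree by degree, with finite sums only, for any pair satisfying the relation. -/
theorem homog_prodCoeff (h : α * β = β * α + β * β) (x y : ℕ → ℕ → ℂ) (d : ℕ) :
    homog α β (prodCoeff x y) d =
      ∑ k ∈ antidiagonal d, homog α β x k.1 * homog α β y k.2 := by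
  have e : ∀ w ∈ antidiagonal d, prodCoeff x y w.1 w.2 • (α ^ w.1 * β ^ w.2) =
      ∑ k ∈ antidiagonal d, ∑ u ∈ antidiagonal k.1, ∑ v ∈ antidiagonal k.2,
        ∑ j ∈ range (v.1 + 1), if u.2 + v.2 + j = w.2 then
          (x u.1 u.2 * y v.1 v.2 * (reord v.1 u.2 j : ℂ)) • (α ^ w.1 * β ^ w.2) else 0 := by
    intro w hw
    rw [prodCoeff, Finset.HasAntidiagonal.mem_antidiagonal.1 hw]
    simp only [sum_smul, mul_sum, mul_ite, mul_zero, ite_smul, zero_smul]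
  rw [homog, sum_congr rfl e, sum_comm]
  refine sum_congr rfl fun k hk => ?_
  rw [homog, homog, sum_mul_sum, sum_comm]
  refine sum_congr rfl fun u hu => ?_
  rw [sum_comm]
  refine sum_congr rfl fun v hv => ?_
  have hk' := Finset.HasAntidiagonal.mem_antidiagonal.1 hk
  have hu' := Finset.HasAntidiagonal.mem_antidiagonal.1 hu
  have hv' := Finset.HasAntidiagonal.mem_antidiagonal.1 hv
  rw [smul_mul_smul_comm, mul_assoc (α ^ u.1), ← mul_assoc (β ^ u.2),
    pow_mul_pow_eq_sum_reord h, sum_mul, mul_sum, smul_sum, sum_comm]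
  refine sum_congr rfl fun j hj => ?_
  have hj' := mem_range.1 hj
  -- For given `j`, the exponents of the monomial that comes from reordering the middle of `α ^ u.1
  -- β ^ u.2 α ^ v.1 β ^ v.2`.
  rw [sum_eq_single (u.1 + (v.1 - j), u.2 + j + v.2)]
  · rw [if_pos (by simp only; ring), smul_mul_assoc, mul_smul_comm, smul_smul, pow_add, pow_add _ (u.2 + j)]
    simp only [mul_assoc]
  · rintro ⟨w1, w2⟩ hw hne
    rw [if_neg]
    rintro h
    apply hne
    have := Finset.HasAntidiagonal.mem_antidiagonal.1 hw
    simp only at this h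
    ext <;> simp only <;> omega
  · intro h
    exact absurd (Finset.HasAntidiagonal.mem_antidiagonal.2 (by simp only; omega)) h

theorem homog_add (x y : ℕ → ℕ → ℂ) (d : ℕ) :
    homog α β (x + y) d = homog α β x d + homog α β y d := by
  simp only [homog, Pi.add_apply, add_smul, sum_add_distrib]

theorem homog_fromA (f : ℂ⟦X⟧) (d : ℕ) : homog α β (fromA f) d = coeff d f • α ^ d := by
  rw [homog, sum_eq_single (d, 0)]
  · simp [fromA]
  · rintro ⟨k1, k2⟩ hk hne
    have : k2 ≠ 0 := by
      rintro rfl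
      exact hne (by simpa using Finset.HasAntidiagonal.mem_antidiagonal.1 hk)
    simp [fromA, this]
  · intro h
    exact absurd (Finset.HasAntidiagonal.mem_antidiagonal.2 (by simp)) h

theorem homog_fromB (f : ℂ⟦X⟧) (d : ℕ) : homog α β (fromB f) d = coeff d f • β ^ d := by
  rw [homog, sum_eq_single (0, d)]
  · simp [fromB]
  · rintro ⟨k1, k2⟩ hk hne
    have : k1 ≠ 0 := by
      rintro rfl
      exact hne (by simpa using Finset.HasAntidiagonal.mem_antidiagonal.1 hk)
    simp [fromB, this]
  · intro h
    exact absurd (Finset.HasAntidiagonal.mem_antidiagonal.2 (by simp)) h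

end Algebra

/-! ### Series of operators that raise the order of formal sequences. -/

section Filtration

variable {F : Type*} [AddCommGroup F] [Module ℂ F]

/-- The sequences of order at least `N`. -/
def fil (F : Type*) [AddCommGroup F] [Module ℂ F] (N : ℕ) : Submodule ℂ (ℕ → F) where
  carrier := {g | ∀ n < N, g n = 0}
  add_mem' h h' n hn := by rw [Pi.add_apply, h n hn, h' n hn, add_zero]
  zero_mem' _ _ := rfl
  smul_mem' c g h n hn := by rw [Pi.smul_apply, h n hn, smul_zero]

theorem fil_anti {N N' : ℕ} (h : N ≤ N') : fil F N' ≤ fil F N :=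
  fun _ hg n hn => hg n (hn.trans_le h)

/-- The sum of a series of sequences of which the `d`-th one has order at least `d`. -/
def formalSum (u : ℕ → ℕ → F) : ℕ → F := fun n => ∑ d ∈ range (n + 1), u d n

theorem formalSum_apply {u : ℕ → ℕ → F} (hu : ∀ d, u d ∈ fil F d) {n N : ℕ} (h : n < N) :
    formalSum u n = ∑ d ∈ range N, u d n := by
  refine sum_subset (range_mono h) fun d _ hd => hu d n ?_
  simpa using hd

omit [Module ℂ F] in
theorem formalSum_add (u v : ℕ → ℕ → F) : formalSum (u + v) = formalSum u + formalSum v := by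
  funext n
  simp [formalSum, sum_add_distrib]

theorem formalSum_smul (c : ℂ) (u : ℕ → ℕ → F) : formalSum (c • u) = c • formalSum u := by
  funext n
  simp [formalSum, smul_sum]

theorem formalSum_eq_single {u : ℕ → ℕ → F} (hu : ∀ d, u d ∈ fil F d) (k : ℕ)
    (h : ∀ d, d ≠ k → u d = 0) : formalSum u = u k := by
  funext n
  rw [formalSum_apply hu (N := n + k + 1) (by omega), sum_eq_single k]
  · intro d _ hd
    rw [h d hd]; rfl
  · intro hk
    exact absurd (mem_range.2 (by omega)) hk

/-- An operator that does not lower the order is continuous for the filtration: its value at index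
`n` depends only on the partial sum up to `n`, where linearity suffices. -/
theorem map_formalSum {T : Module.End ℂ (ℕ → F)} (hT : ∀ N, ∀ g ∈ fil F N, T g ∈ fil F N)
    {u : ℕ → ℕ → F} (hu : ∀ d, u d ∈ fil F d) :
    T (formalSum u) = formalSum fun d => T (u d) := by
  funext n
  have h : formalSum u - ∑ d ∈ range (n + 1), u d ∈ fil F (n + 1) := by
    intro m hm
    rw [Pi.sub_apply, formalSum_apply hu hm, Finset.sum_apply, sub_self]
  have h' := hT _ _ h n (Nat.lt_succ_self n)
  rw [map_sub, map_sum, Pi.sub_apply, sub_eq_zero, Finset.sum_apply] at h'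
  exact h'

theorem formalSum_formalSum {u : ℕ → ℕ → ℕ → F} (hu : ∀ i j, u i j ∈ fil F (i + j)) :
    (formalSum fun i => formalSum (u i)) =
      formalSum fun d => ∑ k ∈ antidiagonal d, u k.1 k.2 := by
  funext n
  simp only [formalSum, Finset.sum_apply]
  rw [sum_congr rfl fun d _ => Nat.sum_antidiagonal_eq_sum_range_succ (fun i j => u i j n) d,
    sum_range_diag_flip (n + 1) fun i j => u i j n]
  -- The regrouped sum stops at `i + j ≤ n`; the other terms have order greater than `n`.
  refine sum_congr rfl fun i hi => (sum_subset (range_mono (by omega)) fun j _ hj => ?_).symm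
  refine hu i j n ?_
  have := mem_range.1 hi
  simp only [mem_range] at hj
  omega

/-- The action of a series `∑ x_{p,q} α ^ p β ^ q` for operators `α` and `β` that raise the order. -/
def seriesAct (α β : Module.End ℂ (ℕ → F)) (x : ℕ → ℕ → ℂ) : Module.End ℂ (ℕ → F) where
  toFun g := formalSum fun d => homog α β x d g
  map_add' g g' := by
    rw [← formalSum_add]
    congr 1
    funext d
    rw [map_add]; rfl
  map_smul' c g := by
    rw [RingHom.id_apply, ← formalSum_smul]
    congr 1
    funext d
    rw [map_smul]; rfl

variable {α β : Module.End ℂ (ℕ → F)} (hα : ∀ N, ∀ g ∈ fil F N, α g ∈ fil F (N + 1))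
  (hβ : ∀ N, ∀ g ∈ fil F N, β g ∈ fil F (N + 1))

theorem pow_mem_fil {T : Module.End ℂ (ℕ → F)} (hT : ∀ N, ∀ g ∈ fil F N, T g ∈ fil F (N + 1))
    (k : ℕ) : ∀ N, ∀ g ∈ fil F N, (T ^ k) g ∈ fil F (N + k) := by
  induction k with
  | zero => intro N g hg; exact hg
  | succ k ih =>
    intro N g hg
    rw [pow_succ']
    exact hT _ _ (ih N g hg)

include hα hβ in
theorem homog_mem_fil (x : ℕ → ℕ → ℂ) (d : ℕ) :
    ∀ N, ∀ g ∈ fil F N, homog α β x d g ∈ fil F (N + d) := by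
  intro N g hg
  rw [homog, LinearMap.sum_apply]
  refine sum_mem fun k hk => ?_
  rw [LinearMap.smul_apply]
  refine Submodule.smul_mem _ _ ?_
  have := pow_mem_fil hα k.1 _ _ (pow_mem_fil hβ k.2 _ _ hg)
  rwa [add_assoc, add_comm k.2, Finset.HasAntidiagonal.mem_antidiagonal.1 hk] at this

include hα hβ in
theorem homog_mem_fil' (x : ℕ → ℕ → ℂ) (d : ℕ) (g : ℕ → F) : homog α β x d g ∈ fil F d := by
  simpa using homog_mem_fil hα hβ x d 0 g (fun n hn => absurd hn (Nat.not_lt_zero n))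

include hα hβ in
-- Continuity moves each homogeneous part inside the inner series, the double series is regrouped by
-- total degree, and `homog_prodCoeff` identifies each degree.
theorem seriesAct_prodCoeff (h : α * β = β * α + β * β) (x y : ℕ → ℕ → ℂ) :
    seriesAct α β (prodCoeff x y) = seriesAct α β x * seriesAct α β y := by
  refine LinearMap.ext fun g => ?_
  change formalSum _ = formalSum fun d => homog α β x d (formalSum _)
  have e : ∀ d, homog α β x d (formalSum fun d' => homog α β y d' g) =
      formalSum fun d' => homog α β x d (homog α β y d' g) := fun d =>
    map_formalSum (fun N g hg => fil_anti (by omega) (homog_mem_fil hα hβ x d N g hg))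
      fun d => homog_mem_fil' hα hβ y d g
  simp only [e]
  rw [formalSum_formalSum]
  · congr 1
    funext d
    rw [homog_prodCoeff h, LinearMap.sum_apply]
    rfl
  · intro i j
    rw [add_comm]
    exact homog_mem_fil hα hβ x i j _ (homog_mem_fil' hα hβ y j g)

theorem seriesAct_add (x y : ℕ → ℕ → ℂ) :
    seriesAct α β (x + y) = seriesAct α β x + seriesAct α β y := by
  refine LinearMap.ext fun g => ?_
  rw [LinearMap.add_apply]
  refine Eq.trans ?_ (formalSum_add _ _)
  change formalSum _ = _
  congr 1
  funext d
  rw [homog_add]; rfl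

include hα hβ in
theorem seriesAct_fromA_C (z : ℂ) : seriesAct α β (fromA (C z)) = algebraMap ℂ _ z := by
  refine LinearMap.ext fun g => ?_
  change formalSum _ = _
  rw [formalSum_eq_single (fun d => homog_mem_fil' hα hβ _ d g) 0]
  · simp [homog_fromA]
  · intro d hd
    simp [homog_fromA, coeff_C, hd]

/-- The coefficients of an element of the convergent algebra. -/
def coeffs (T : ConvAB) : ℕ → ℕ → ℂ := T.2.choose

theorem bounded_coeffs (T : ConvAB) : Bounded (coeffs T) := T.2.choose_spec.1

theorem op_coeffs (T : ConvAB) : op (coeffs T) = T := T.2.choose_spec.2.symm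

/-- Injectivity of `op` makes the chosen coefficients the only possible ones; this turns sums and
products of operators into sums and products of coefficients. -/
theorem coeffs_eq {T : ConvAB} {x : ℕ → ℕ → ℂ} (h : op x = T) : (coeffs T) = x :=
  op_injective ((op_coeffs T).trans h.symm)

/-- The representation of the convergent algebra on sequences given by two operators that raise the order
and satisfy `α β - β α = β ^ 2`. -/
def seriesRep (α β : Module.End ℂ (ℕ → F)) (hα : ∀ N, ∀ g ∈ fil F N, α g ∈ fil F (N + 1))
    (hβ : ∀ N, ∀ g ∈ fil F N, β g ∈ fil F (N + 1)) (h : α * β = β * α + β * β) :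
    ConvAB →ₐ[ℂ] Module.End ℂ (ℕ → F) :=
  have hC : ∀ z : ℂ, seriesAct α β (coeffs (algebraMap ℂ ConvAB z)) = algebraMap ℂ _ z := by
    intro z
    rw [coeffs_eq (x := fromA (C z)), seriesAct_fromA_C hα hβ]
    refine LinearMap.ext fun g => ?_
    rw [op_fromA, ← smul_eq_C_mul]
    rfl
  { toFun T := seriesAct α β (coeffs T)
    map_one' := by simpa using hC 1
    map_zero' := by simpa using hC 0
    map_mul' T T' := by
      rw [← seriesAct_prodCoeff hα hβ h, coeffs_eq]
      rw [← op_mul_op, op_coeffs T, op_coeffs T']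
      rfl
    map_add' T T' := by
      rw [← seriesAct_add, coeffs_eq]
      rw [← op_add_op, op_coeffs T, op_coeffs T']
      rfl
    commutes' := hC }

theorem coeffs_ofA (f : HolA) : coeffs (ofA f) = fromA f := coeffs_eq rfl

theorem coeffs_ofB (f : GevB) : coeffs (ofB f) = fromB f := coeffs_eq rfl

end Filtration

/-! ### Multiplication by `s`. -/

section Shift

variable {F : Type*} [AddCommGroup F] [Module ℂ F]

/-- The multiplication by `s` on sequences of coefficients. -/
def shift : Module.End ℂ (ℕ → F) where
  toFun g n := match n with
    | 0 => 0
    | n + 1 => g n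
  map_add' g g' := by funext n; cases n <;> simp
  map_smul' c g := by funext n; cases n <;> simp

@[simp] theorem shift_zero (g : ℕ → F) : shift g 0 = 0 := rfl

@[simp] theorem shift_succ (g : ℕ → F) (n : ℕ) : shift g (n + 1) = g n := rfl

theorem shift_mem_fil (N : ℕ) (g : ℕ → F) (hg : g ∈ fil F N) : shift g ∈ fil F (N + 1) := by
  intro n hn
  cases n with
  | zero => rfl
  | succ n => exact hg n (by omega)

theorem shift_injective : Function.Injective (shift : (ℕ → F) → (ℕ → F)) :=
  fun _ _ h => funext fun n => congrFun h (n + 1)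

/-- The constant sequences. -/
def constSeq (v : F) : ℕ → F := fun n => if n = 0 then v else 0

end Shift

/-! ### The formal theory of a system: `D`, `b = s D⁻¹` and the expansion in powers of `b`. -/

/-- A system `s dF/ds = (∑ L_n s ^ n) F` with convergent coefficients, for which the operators `n + L_0` are
invertible for all `n`. -/
structure SimplePoleSystem (F : Type*) [NormedAddCommGroup F] [NormedSpace ℂ F] where
  L : ℕ → Module.End ℂ F
  J : ℕ → Module.End ℂ F
  J_apply : ∀ (n : ℕ) v, J n ((n : ℂ) • v + L 0 v) = v
  apply_J : ∀ (n : ℕ) v, (n : ℂ) • J n v + L 0 (J n v) = v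
  m : ℝ
  r : ℝ
  κ : ℝ
  m_nonneg : 0 ≤ m
  one_le_r : 1 ≤ r
  κ_nonneg : 0 ≤ κ
  norm_L : ∀ n v, ‖L n v‖ ≤ m * r ^ n * ‖v‖
  norm_J : ∀ n v, ‖J n v‖ ≤ κ / (n + 1) * ‖v‖

namespace SimplePoleSystem

variable {F : Type*} [NormedAddCommGroup F] [NormedSpace ℂ F] (S : SimplePoleSystem F)

/-- The operator `s d/ds + ∑ L_n s ^ n`. -/
def D : Module.End ℂ (ℕ → F) where
  toFun h n := (n : ℂ) • h n + ∑ j ∈ range (n + 1), S.L (n - j) (h j)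
  map_add' g g' := by
    funext n
    simp only [Pi.add_apply, smul_add, map_add, sum_add_distrib]
    abel
  map_smul' c g := by
    funext n
    simp only [Pi.smul_apply, map_smul, RingHom.id_apply, smul_add, smul_sum, smul_comm c]

theorem D_apply (h : ℕ → F) (n : ℕ) :
    S.D h n = (n : ℂ) • h n + ∑ j ∈ range (n + 1), S.L (n - j) (h j) := rfl

theorem D_apply' (h : ℕ → F) (n : ℕ) :
    S.D h n = ∑ j ∈ range n, S.L (n - j) (h j) + ((n : ℂ) • h n + S.L 0 (h n)) := by
  rw [D_apply, sum_range_succ, Nat.sub_self]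
  abel

/-- `D` is triangular with diagonal blocks `n + L_0`, so each coefficient of `h` is recovered from
`D h` and the earlier coefficients. -/
theorem apply_eq (h : ℕ → F) (n : ℕ) :
    h n = S.J n (S.D h n - ∑ j ∈ range n, S.L (n - j) (h j)) := by
  rw [D_apply', add_sub_cancel_left, S.J_apply]

/-- The solution of `D h = g`. -/
def solve (g : ℕ → F) (n : ℕ) : F :=
  S.J n (g n - ∑ j : Fin n, S.L (n - j) (solve g j))
decreasing_by exact j.2

theorem D_solve (g : ℕ → F) : S.D (S.solve g) = g := by
  funext n
  rw [D_apply', solve, S.apply_J, Fin.sum_univ_eq_sum_range fun j => S.L (n - j) (S.solve g j)]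
  abel

theorem mem_fil_of_D {N : ℕ} {h : ℕ → F} (H : S.D h ∈ fil F N) : h ∈ fil F N := by
  intro n
  induction n using Nat.strong_induction_on with
  | _ n ih =>
    intro hn
    rw [S.apply_eq h n, H n hn, sum_eq_zero, sub_zero, map_zero]
    intro j hj
    have := mem_range.1 hj
    rw [ih j this (by omega), map_zero]

theorem D_injective : Function.Injective S.D := by
  refine (injective_iff_map_eq_zero S.D).2 fun h hh => funext fun n => ?_
  exact S.mem_fil_of_D (N := n + 1) (by rw [hh]; exact zero_mem _) n (Nat.lt_succ_self n)

/-- `D` as a linear equivalence. -/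
def DEquiv : (ℕ → F) ≃ₗ[ℂ] (ℕ → F) :=
  LinearEquiv.ofBijective S.D ⟨S.D_injective, fun g => ⟨S.solve g, S.D_solve g⟩⟩

/-- The operator `b = s D⁻¹`. -/
def beta : Module.End ℂ (ℕ → F) := shift * S.DEquiv.symm.toLinearMap

theorem beta_D (h : ℕ → F) : S.beta (S.D h) = shift h :=
  congrArg shift (S.DEquiv.symm_apply_apply h)

theorem exists_D (g : ℕ → F) : ∃ h, S.D h = g := ⟨S.solve g, S.D_solve g⟩

theorem beta_mem_fil (N : ℕ) (g : ℕ → F) (hg : g ∈ fil F N) : S.beta g ∈ fil F (N + 1) := by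
  obtain ⟨h, rfl⟩ := S.exists_D g
  rw [beta_D]
  exact shift_mem_fil _ _ (S.mem_fil_of_D hg)

theorem beta_injective : Function.Injective S.beta := by
  intro g g' H
  obtain ⟨h, rfl⟩ := S.exists_D g
  obtain ⟨h', rfl⟩ := S.exists_D g'
  rw [beta_D, beta_D] at H
  rw [shift_injective H]

/-- The extra term is the Leibniz rule for `s d/ds`; multiplication by the coefficients of the
system commutes with `s`. -/
theorem D_shift (h : ℕ → F) : S.D (shift h) = shift (S.D h) + shift h := by
  funext n
  cases n with
  | zero => simp [D_apply]
  | succ n =>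
    rw [D_apply, sum_range_succ', Pi.add_apply, shift_succ, shift_succ, D_apply, shift_zero,
      map_zero, add_zero]
    simp only [shift_succ, Nat.add_sub_add_right]
    push_cast
    rw [add_smul, one_smul]
    abel

/-- With `g = D h`, `a b g = s ^ 2 h` while `b a g + b (b g) = b (s D h + s h) = b (D (s h))`, which
is the same. -/
theorem comm_rel : shift * S.beta = S.beta * shift + S.beta * S.beta := by
  refine LinearMap.ext fun g => ?_
  obtain ⟨h, rfl⟩ := S.exists_D g
  simp only [Module.End.mul_apply, LinearMap.add_apply, beta_D]
  rw [← map_add, ← S.D_shift, beta_D]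

/-- The representation of the convergent algebra on formal sequences, where `a` is the multiplication by `s`
and `b = s D⁻¹`. -/
def rep : ConvAB →ₐ[ℂ] Module.End ℂ (ℕ → F) :=
  seriesRep shift S.beta shift_mem_fil S.beta_mem_fil S.comm_rel

theorem rep_apply (T : ConvAB) (g : ℕ → F) :
    S.rep T g = formalSum fun d => homog shift S.beta (coeffs T) d g := rfl

theorem rep_ofA (f : HolA) (g : ℕ → F) :
    S.rep (ofA f) g = formalSum fun d => coeff d (f : ℂ⟦X⟧) • (shift ^ d) g := by
  rw [rep_apply, coeffs_ofA]
  simp only [homog_fromA]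
  rfl

theorem rep_ofB (f : GevB) (g : ℕ → F) :
    S.rep (ofB f) g = formalSum fun d => coeff d (f : ℂ⟦X⟧) • (S.beta ^ d) g := by
  rw [rep_apply, coeffs_ofB]
  simp only [homog_fromB]
  rfl

theorem beta_pow_mem_fil (g : ℕ → F) (d : ℕ) : (S.beta ^ d) g ∈ fil F d := by
  simpa using pow_mem_fil S.beta_mem_fil d 0 g fun n hn => absurd hn (Nat.not_lt_zero n)

theorem shift_pow_mem_fil (g : ℕ → F) (d : ℕ) : (shift ^ d) g ∈ fil F d := by
  simpa using pow_mem_fil shift_mem_fil d 0 g fun n hn => absurd hn (Nat.not_lt_zero n)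

theorem rep_aOp : S.rep aOp = shift := by
  refine LinearMap.ext fun g => ?_
  rw [aOp, rep_ofA, formalSum_eq_single
    (fun d => Submodule.smul_mem _ _ (shift_pow_mem_fil g d)) 1]
  · simp
  · intro d hd
    simp [coeff_X, hd]

theorem rep_bOp : S.rep bOp = S.beta := by
  refine LinearMap.ext fun g => ?_
  rw [bOp, rep_ofB, formalSum_eq_single
    (fun d => Submodule.smul_mem _ _ (S.beta_pow_mem_fil g d)) 1]
  · simp [b]
  · intro d hd
    simp [b, coeff_X, hd]

/-- The image of a constant vector by `D`. -/
def gen : F →ₗ[ℂ] (ℕ → F) := LinearMap.pi S.L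

theorem gen_apply (v : F) (n : ℕ) : S.gen v n = S.L n v := rfl

theorem D_constSeq (v : F) : S.D (constSeq v) = S.gen v := by
  funext n
  rw [D_apply, sum_range_succ', gen_apply]
  cases n <;> simp [constSeq]

/-- This is the reason for taking `D` of the constants as basis: `b` sends it to `s` times the
constants, on which series in `a` act by plain multiplication. -/
theorem beta_gen (v : F) : S.beta (S.gen v) = shift (constSeq v) := by
  rw [← D_constSeq, beta_D]

/-- The element `∑ b ^ q e(x_q)`. -/
def expand : (ℕ → F) →ₗ[ℂ] (ℕ → F) where
  toFun x := formalSum fun q => (S.beta ^ q) (S.gen (x q))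
  map_add' x y := by
    rw [← formalSum_add]
    congr 1
    funext q
    simp
  map_smul' c x := by
    rw [RingHom.id_apply, ← formalSum_smul]
    congr 1
    funext q
    simp

theorem expand_apply (x : ℕ → F) :
    S.expand x = formalSum fun q => (S.beta ^ q) (S.gen (x q)) := rfl

theorem beta_formalSum {u : ℕ → ℕ → F} (hu : ∀ d, u d ∈ fil F d) (k : ℕ) :
    (S.beta ^ k) (formalSum u) = formalSum fun d => (S.beta ^ k) (u d) :=
  map_formalSum (fun N g hg => fil_anti (by omega) (pow_mem_fil S.beta_mem_fil k N g hg)) hu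

theorem expand_zero (x : ℕ → F) : S.expand x 0 = S.L 0 (x 0) := by
  simp [expand_apply, formalSum, gen_apply]

/-- Horner form of the expansion: separating the term `q = 0` leaves `b` times the expansion of the
shifted sequence. -/
theorem expand_eq (x : ℕ → F) :
    S.expand x = S.gen (x 0) + S.beta (S.expand fun n => x (n + 1)) := by
  have h := S.beta_formalSum (fun q => S.beta_pow_mem_fil (S.gen (x (q + 1))) q) 1
  rw [pow_one] at h
  rw [expand_apply, expand_apply, h]
  funext n
  -- One more term than necessary, zero at index `n`, so that removing the first leaves the `n + 1`
  -- terms of the other side.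
  rw [formalSum_apply (N := n + 2) (fun q => S.beta_pow_mem_fil _ _) (by omega), Pi.add_apply,
    sum_range_succ', add_comm, formalSum]
  simp [pow_succ']

/-- The recursion that computes the inverse of `expand`. -/
def remainder (g : ℕ → F) : ℕ → ℕ → F
  | 0 => g
  | k + 1 => S.D fun n => remainder g k (n + 1) - S.L (n + 1) (S.J 0 (remainder g k 0))

/-- The coefficients of `g` with respect to the `b ^ q e`. -/
def digits (g : ℕ → F) (k : ℕ) : F := S.J 0 (S.remainder g k 0)

/-- Division by `b`: the digit is chosen so that subtracting its generator kills the constant term,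
and the rest has the form `s h = b (D h)`. -/
theorem remainder_eq (g : ℕ → F) (k : ℕ) :
    S.remainder g k = S.gen (S.digits g k) + S.beta (S.remainder g (k + 1)) := by
  rw [remainder, beta_D]
  funext n
  cases n with
  | zero =>
    have := S.apply_J 0 (S.remainder g k 0)
    simp only [Nat.cast_zero, zero_smul, zero_add] at this
    simp [gen_apply, digits, this]
  | succ n => simp [gen_apply, digits]

/-- Remainders and expansions obey the same recursion, so their difference at stage `k` is `b` times
the difference at stage `k + 1`. Each stage gains one order, whence the induction for all `k` at
once. -/
theorem remainder_sub_expand_mem (N : ℕ) (g : ℕ → F) (k : ℕ) :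
    S.remainder g k - S.expand (fun n => S.digits g (n + k)) ∈ fil F N := by
  induction N generalizing k with
  | zero => exact fun n hn => absurd hn (Nat.not_lt_zero n)
  | succ N ih =>
    rw [S.remainder_eq, S.expand_eq, zero_add, add_sub_add_left_eq_sub, ← map_sub]
    have := S.beta_mem_fil _ _ (ih (k + 1))
    simpa only [add_assoc, add_comm 1 k] using this

theorem expand_digits (g : ℕ → F) : S.expand (S.digits g) = g := by
  funext n
  have := S.remainder_sub_expand_mem (n + 1) g 0 n (Nat.lt_succ_self n)
  exact (sub_eq_zero.1 this).symm

theorem L_zero_injective : Function.Injective (S.L 0) := by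
  intro v w h
  have h1 := S.J_apply 0 v
  have h2 := S.J_apply 0 w
  rw [h] at h1
  simp only [Nat.cast_zero, zero_smul] at h1 h2
  rw [← h1, h2]

theorem expand_injective : Function.Injective S.expand := by
  refine (injective_iff_map_eq_zero S.expand).2 fun x hx => funext fun n => ?_
  induction n generalizing x with
  | zero =>
    have := congrFun hx 0
    rw [expand_zero, Pi.zero_apply] at this
    exact S.L_zero_injective (this.trans (map_zero _).symm)
  | succ n ih =>
    refine ih (fun n => x (n + 1)) ?_
    have h0 : x 0 = 0 := by
      have := congrFun hx 0
      rw [expand_zero, Pi.zero_apply] at this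
      exact S.L_zero_injective (this.trans (map_zero _).symm)
    rw [expand_eq, h0, map_zero, zero_add] at hx
    exact S.beta_injective (hx.trans (map_zero _).symm)

/-- In powers of `b` the action of `B` becomes the Cauchy product, that is, the given `B`-module
structure of `B ^ p`. -/
theorem rep_ofB_expand (f : GevB) (x : ℕ → F) :
    S.rep (ofB f) (S.expand x) =
      S.expand fun n => ∑ k ∈ antidiagonal n, coeff k.1 (f : ℂ⟦X⟧) • x k.2 := by
  rw [rep_ofB, expand_apply, expand_apply]
  simp only [S.beta_formalSum (fun q => S.beta_pow_mem_fil (S.gen (x q)) q), ← formalSum_smul]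
  rw [formalSum_formalSum]
  · congr 1
    funext d
    simp only [map_sum, map_smul]
    refine sum_congr rfl fun k hk => ?_
    rw [← Finset.HasAntidiagonal.mem_antidiagonal.1 hk, pow_add]
    rfl
  · intro i j
    rw [Pi.smul_apply, ← Module.End.mul_apply, ← pow_add]
    exact Submodule.smul_mem _ _ (S.beta_pow_mem_fil _ _)

end SimplePoleSystem

/-! ### Estimates for `D`, the powers of `b` and the digits. -/

/-- The product `(n + 1) ⋯ (n + k)` grows with `n`. -/
theorem ascFactorial_mono (k : ℕ) : Monotone fun n : ℕ => (n + 1).ascFactorial k := by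
  intro m n h
  induction k with
  | zero => simp
  | succ k ih =>
    simp only [Nat.ascFactorial_succ] at ih ⊢
    exact Nat.mul_le_mul (by omega) ih

namespace SimplePoleSystem

variable {F : Type*} [NormedAddCommGroup F] [NormedSpace ℂ F] (S : SimplePoleSystem F)

/-- The threshold for `R` is the one for which the recursion of these sums closes. It makes the
convolution in `D h` no larger than the source term in `norm_le_of_D`. -/
theorem sum_geom_le {R : ℝ} (hR : S.r * (1 + 2 * S.κ * S.m) ≤ R) (n : ℕ) :
    2 * S.κ * S.m * ∑ j ∈ range n, S.r ^ (n - j) * R ^ j ≤ R ^ n := by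
  have h0 := S.m_nonneg
  have h1 := S.one_le_r
  have h2 := S.κ_nonneg
  have hR0 : 0 ≤ R := le_trans (by positivity) hR
  induction n with
  | zero => simp
  | succ n ih =>
    have e : ∑ j ∈ range (n + 1), S.r ^ (n + 1 - j) * R ^ j =
        S.r * (∑ j ∈ range n, S.r ^ (n - j) * R ^ j + R ^ n) := by
      rw [sum_range_succ, mul_add, mul_sum]
      congr 1
      · refine sum_congr rfl fun j hj => ?_
        rw [Nat.succ_sub (mem_range.1 hj).le, pow_succ]
        ring
      · simp
    rw [e]
    calc _ = S.r * (2 * S.κ * S.m * ∑ j ∈ range n, S.r ^ (n - j) * R ^ j) +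
          S.r * (2 * S.κ * S.m) * R ^ n := by ring
      _ ≤ S.r * R ^ n + S.r * (2 * S.κ * S.m) * R ^ n := by gcongr
      _ = (S.r * (1 + 2 * S.κ * S.m)) * R ^ n := by ring
      _ ≤ R * R ^ n := by gcongr
      _ = R ^ (n + 1) := by ring

/-- Only indices `n ≥ q` matter, and there `J n` gains `κ / (n + 1) ≤ κ / (q + 1)`. The factor `2`
counts the source term and the convolution of earlier coefficients. That `R` does not depend on `q`
allows iteration. -/
theorem norm_le_of_D {R c : ℝ} (hR : S.r * (1 + 2 * S.κ * S.m) ≤ R) (hc : 0 ≤ c) {q : ℕ}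
    {h : ℕ → F} (hq : S.D h ∈ fil F q) (hb : ∀ n, ‖S.D h n‖ ≤ c * R ^ n) (n : ℕ) :
    ‖h n‖ ≤ 2 * S.κ / (q + 1) * c * R ^ n := by
  have h0 := S.m_nonneg
  have h1 := S.one_le_r
  have h2 := S.κ_nonneg
  have hR0 : 0 ≤ R := le_trans (by positivity) hR
  induction n using Nat.strong_induction_on with
  | _ n ih =>
    rcases lt_or_ge n q with hn | hn
    · rw [S.mem_fil_of_D hq n hn, norm_zero]
      positivity
    · have hs : ‖∑ j ∈ range n, S.L (n - j) (h j)‖ ≤ c * R ^ n := by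
        calc _ ≤ ∑ j ∈ range n, S.m * S.r ^ (n - j) * (2 * S.κ / (q + 1) * c * R ^ j) :=
              norm_sum_le_of_le _ fun j hj => (S.norm_L _ _).trans (by
                have := ih j (mem_range.1 hj)
                gcongr)
          _ = c / (q + 1) * (2 * S.κ * S.m * ∑ j ∈ range n, S.r ^ (n - j) * R ^ j) := by
              rw [mul_sum, mul_sum]
              exact sum_congr rfl fun j _ => by ring
          _ ≤ c / (q + 1) * R ^ n := by
              gcongr
              exact S.sum_geom_le hR n
          _ ≤ c * R ^ n := by
              gcongr
              exact div_le_self hc (by norm_cast; omega)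
      rw [S.apply_eq h n]
      calc _ ≤ S.κ / (n + 1) * (c * R ^ n + c * R ^ n) :=
            (S.norm_J _ _).trans (by
              gcongr
              exact (norm_sub_le _ _).trans (add_le_add (hb n) hs))
        _ ≤ S.κ / (q + 1) * (c * R ^ n + c * R ^ n) := by gcongr
        _ = _ := by ring

/-- As `b ^ q g` has order at least `q`, the next `D⁻¹` gains `1 / (q + 1)`; the product of the
gains is the `1 / q!` that compensates the growth allowed in `B`. -/
theorem norm_beta_pow_le {R C : ℝ} (hR : S.r * (1 + 2 * S.κ * S.m) ≤ R) (hC : 0 ≤ C)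
    {g : ℕ → F} (hg : ∀ n, ‖g n‖ ≤ C * R ^ n) (q n : ℕ) :
    ‖(S.beta ^ q) g n‖ ≤ C * (2 * S.κ) ^ q / q ! * R ^ n := by
  have h0 := S.m_nonneg
  have h1 := S.one_le_r
  have h2 := S.κ_nonneg
  have hR1 : 1 ≤ R := by
    refine le_trans ?_ hR
    have : 0 ≤ S.κ * S.m := by positivity
    nlinarith
  induction q generalizing n with
  | zero => simpa using hg n
  | succ q ih =>
    obtain ⟨h, hh⟩ := S.exists_D ((S.beta ^ q) g)
    rw [pow_succ', Module.End.mul_apply, ← hh, beta_D]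
    cases n with
    | zero =>
      rw [shift_zero, norm_zero]
      positivity
    | succ n =>
      rw [shift_succ]
      refine (S.norm_le_of_D hR (q := q) (c := C * (2 * S.κ) ^ q / q !) (by positivity) ?_ ?_ n).trans ?_
      · rw [hh]; exact S.beta_pow_mem_fil g q
      · rw [hh]; exact ih
      · have e : 2 * S.κ / (q + 1) * (C * (2 * S.κ) ^ q / q !) =
            C * (2 * S.κ) ^ (q + 1) / (q + 1)! := by
          rw [Nat.factorial_succ]
          push_cast
          field_simp
          ring
        rw [e]
        gcongr
        exact Nat.le_succ n

/-- The derivative contributes `n` and the convolution `n + 1` comparable terms, so `D` costs a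
factor `n + 1`, which extends the rising product `(n + 2) ⋯ (n + k + 1)` downwards by one. -/
theorem norm_D_le {R c : ℝ} (hR : S.r ≤ R) (hc : 0 ≤ c) (k : ℕ) {h : ℕ → F}
    (hh : ∀ n, ‖h n‖ ≤ c * R ^ n * (n + 2).ascFactorial k) (n : ℕ) :
    ‖S.D h n‖ ≤ c * (1 + S.m) * R ^ n * (n + 1).ascFactorial (k + 1) := by
  have h0 := S.m_nonneg
  have h1 := S.one_le_r
  have hR0 : 0 ≤ R := by linarith
  have e : ((n + 1).ascFactorial (k + 1) : ℝ) = (n + 1) * (n + 2).ascFactorial k := by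
    have : (n + 1) * (n + 2).ascFactorial k = (n + 1).ascFactorial (k + 1) := by
      rw [Nat.ascFactorial_succ, ← Nat.succ_ascFactorial]
    rw [← this]
    push_cast
    ring
  rw [D_apply, e]
  have b1 : ‖(n : ℂ) • h n‖ ≤ (n + 1) * (c * R ^ n * (n + 2).ascFactorial k) := by
    rw [norm_smul, Complex.norm_natCast]
    gcongr
    · linarith
    · exact hh n
  have b2 : ‖∑ j ∈ range (n + 1), S.L (n - j) (h j)‖ ≤
      ∑ j ∈ range (n + 1), S.m * (c * R ^ n * (n + 2).ascFactorial k) := by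
    refine norm_sum_le_of_le _ fun j hj => (S.norm_L _ _).trans ?_
    have hj' : j ≤ n := by have := mem_range.1 hj; omega
    have hm : ((j + 2).ascFactorial k : ℝ) ≤ (n + 2).ascFactorial k := by
      exact_mod_cast ascFactorial_mono k (Nat.succ_le_succ hj')
    calc _ ≤ S.m * R ^ (n - j) * (c * R ^ j * (n + 2).ascFactorial k) := by
          gcongr
          exact (hh j).trans (by gcongr)
      _ = S.m * (c * (R ^ (n - j) * R ^ j) * (n + 2).ascFactorial k) := by ring
      _ = _ := by rw [← pow_add, Nat.sub_add_cancel hj']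
  rw [sum_const, card_range, nsmul_eq_mul] at b2
  push_cast at b2
  refine (norm_add_le _ _).trans ((add_le_add b1 b2).trans (le_of_eq ?_))
  ring

theorem norm_J_zero_le (v : F) : ‖S.J 0 v‖ ≤ S.κ * ‖v‖ := by simpa using S.norm_J 0 v

/-- Each step shifts the index by one and applies `D`, so `k` steps cost `(n + 1) ⋯ (n + k)`; at `n
= 0` this is the `k!` of the digits. -/
theorem norm_remainder_le {R C : ℝ} (hR : S.r ≤ R) (hC : 0 ≤ C) {g : ℕ → F}
    (hg : ∀ n, ‖g n‖ ≤ C * R ^ n) (k n : ℕ) :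
    ‖S.remainder g k n‖ ≤
      C * (R * (1 + S.m * S.κ) * (1 + S.m)) ^ k * R ^ n * (n + 1).ascFactorial k := by
  have h0 := S.m_nonneg
  have h1 := S.one_le_r
  have h2 := S.κ_nonneg
  have hR0 : 0 ≤ R := by linarith
  induction k generalizing n with
  | zero => simpa [remainder] using hg n
  | succ k ih =>
    set K := R * (1 + S.m * S.κ) * (1 + S.m) with hK
    have hK0 : 0 ≤ K := by positivity
    refine (S.norm_D_le (c := C * K ^ k * (R * (1 + S.m * S.κ))) hR (by positivity) k ?_ n).trans
      (le_of_eq ?_)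
    · intro n
      -- The correction term involves the remainder at index `0`; it is given the larger weight of
      -- index `n + 1`, so that both terms are bounded alike.
      have hm : ((0 + 1).ascFactorial k : ℝ) ≤ (n + 1 + 1).ascFactorial k := by
        exact_mod_cast ascFactorial_mono k (Nat.zero_le (n + 1))
      have b1 := ih (n + 1)
      have b2 : ‖S.L (n + 1) (S.J 0 (S.remainder g k 0))‖ ≤
          S.m * R ^ (n + 1) * (S.κ * (C * K ^ k * (n + 1 + 1).ascFactorial k)) := by
        refine (S.norm_L _ _).trans ?_
        have := (S.norm_J_zero_le (S.remainder g k 0)).trans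
          (mul_le_mul_of_nonneg_left (ih 0) h2)
        rw [pow_zero, mul_one] at this
        gcongr
        refine this.trans ?_
        gcongr
      refine (norm_sub_le _ _).trans ((add_le_add b1 b2).trans (le_of_eq ?_))
      ring
    · rw [hK]
      ring

theorem norm_digits_le {R C : ℝ} (hR : S.r ≤ R) (hC : 0 ≤ C) {g : ℕ → F}
    (hg : ∀ n, ‖g n‖ ≤ C * R ^ n) (k : ℕ) :
    ‖S.digits g k‖ ≤ S.κ * C * (R * (1 + S.m * S.κ) * (1 + S.m)) ^ k * k ! := by
  refine (S.norm_J_zero_le _).trans ?_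
  have h := mul_le_mul_of_nonneg_left (S.norm_remainder_le hR hC hg k 0) S.κ_nonneg
  rw [zero_add, Nat.one_ascFactorial, pow_zero, mul_one] at h
  refine h.trans (le_of_eq ?_)
  ring

end SimplePoleSystem

/-! ### Convergent and Gevrey sequences. -/

section Growth

variable {F : Type*} [NormedAddCommGroup F]

/-- Convergence of `∑ g_n s ^ n`. -/
def IsConvergent (g : ℕ → F) : Prop :=
  ∃ R : ℝ, 1 < R ∧ ∃ C : ℝ, ∀ n, ‖g n‖ ≤ C * R ^ n

/-- The growth condition of the series in `B`. -/
def IsGevrey (x : ℕ → F) : Prop :=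
  ∃ R : ℝ, 1 < R ∧ ∃ C : ℝ, ∀ n, ‖x n‖ ≤ C * R ^ n * n !

theorem IsConvergent.exists_ge {g : ℕ → F} (hg : IsConvergent g) (R₀ : ℝ) :
    ∃ R C : ℝ, R₀ ≤ R ∧ 1 < R ∧ 0 ≤ C ∧ ∀ n, ‖g n‖ ≤ C * R ^ n := by
  obtain ⟨R, hR, C, hg⟩ := hg
  have hC : 0 ≤ C := by simpa using (norm_nonneg _).trans (hg 0)
  refine ⟨max R₀ R, C, le_max_left _ _, lt_max_of_lt_right hR, hC, fun n => (hg n).trans ?_⟩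
  gcongr
  exact le_max_right _ _

theorem isConvergent_of_le {g : ℕ → F} {K C : ℝ} (hK : 0 ≤ K)
    (h : ∀ n, ‖g n‖ ≤ C * K ^ n * ((n : ℝ) + 1) ^ 2) : IsConvergent g := by
  have hC : 0 ≤ C := by simpa using (norm_nonneg _).trans (h 0)
  -- The polynomial factor is absorbed by `(n + 1) ^ 2 ≤ 4 ^ n`; the `2` keeps the rate above `1`.
  refine ⟨4 * K + 2, by linarith, C, fun n => (h n).trans ?_⟩
  have h2 : ((n : ℝ) + 1) ≤ 2 ^ n := by exact_mod_cast Nat.lt_two_pow_self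
  calc C * K ^ n * ((n : ℝ) + 1) ^ 2 ≤ C * K ^ n * (2 ^ n) ^ 2 := by gcongr
    _ = C * (4 * K) ^ n := by
      rw [mul_pow, ← pow_mul, mul_comm n 2, pow_mul]
      norm_num
      ring
    _ ≤ _ := by
      gcongr
      linarith

end Growth

namespace SimplePoleSystem

variable {F : Type*} [NormedAddCommGroup F] [NormedSpace ℂ F] (S : SimplePoleSystem F)

theorem isConvergent_D {h : ℕ → F} (hh : IsConvergent h) : IsConvergent (S.D h) := by
  obtain ⟨R, C, hR, hR1, hC, hh⟩ := hh.exists_ge S.r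
  have h0 := S.m_nonneg
  refine isConvergent_of_le (K := R) (C := C * (1 + S.m)) (by linarith) fun n => ?_
  refine (S.norm_D_le (c := C) hR hC 0 (by simpa using hh) n).trans ?_
  simp only [Nat.ascFactorial_succ, Nat.ascFactorial_zero]
  push_cast
  gcongr
  nlinarith

theorem isGevrey_digits {g : ℕ → F} (hg : IsConvergent g) : IsGevrey (S.digits g) := by
  obtain ⟨R, C, hR, hR1, hC, hg⟩ := hg.exists_ge S.r
  have h0 := S.m_nonneg
  have h2 := S.κ_nonneg
  refine ⟨R * (1 + S.m * S.κ) * (1 + S.m), ?_, S.κ * C, S.norm_digits_le hR hC hg⟩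
  have : 0 ≤ S.m * S.κ := by positivity
  have h3 : R ≤ R * (1 + S.m * S.κ) := le_mul_of_one_le_right (by linarith) (by linarith)
  have h4 : R * (1 + S.m * S.κ) ≤ R * (1 + S.m * S.κ) * (1 + S.m) :=
    le_mul_of_one_le_right (by linarith) (by linarith)
  linarith

theorem isConvergent_expand {x : ℕ → F} (hx : IsGevrey x) : IsConvergent (S.expand x) := by
  obtain ⟨Q, hQ, C, hx⟩ := hx
  have hC : 0 ≤ C := by simpa using (norm_nonneg _).trans (hx 0)
  have h0 := S.m_nonneg
  have h1 := S.one_le_r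
  have h2 := S.κ_nonneg
  set R := S.r * (1 + 2 * S.κ * S.m) with hR
  have hrR : S.r ≤ R := le_mul_of_one_le_right (by linarith) (by
    have : 0 ≤ S.κ * S.m := by positivity
    linarith)
  -- After the factorials cancel, `Q * (2 κ)` to the power `q` remains; adding `1` permits replacing
  -- `q` by `n`.
  set K := Q * (2 * S.κ) + 1 with hK
  have hK1 : 1 ≤ K := by
    have : 0 ≤ Q * (2 * S.κ) := by positivity
    linarith
  refine isConvergent_of_le (K := K * R) (C := S.m * C) (by positivity) fun n => ?_
  rw [expand_apply]
  have b : ∀ q ∈ range (n + 1), ‖(S.beta ^ q) (S.gen (x q)) n‖ ≤ S.m * C * (K * R) ^ n := by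
    intro q hq
    have hq' : q ≤ n := by have := mem_range.1 hq; omega
    have hb := S.norm_beta_pow_le (R := R) (C := S.m * (C * Q ^ q * q !)) (g := S.gen (x q)) le_rfl
      (by positivity) (fun n => by
        rw [gen_apply]
        refine (S.norm_L n (x q)).trans ?_
        calc _ ≤ S.m * R ^ n * (C * Q ^ q * q !) := by gcongr; exact hx q
          _ = _ := by ring) q n
    refine hb.trans ?_
    calc _ = S.m * C * (Q * (2 * S.κ)) ^ q * R ^ n := by
          have : ((q ! : ℕ) : ℝ) ≠ 0 := by exact_mod_cast Nat.factorial_ne_zero q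
          rw [mul_pow Q]
          field_simp
      _ ≤ S.m * C * K ^ q * R ^ n := by
          gcongr
          linarith
      _ ≤ S.m * C * K ^ n * R ^ n := by gcongr
      _ = _ := by rw [mul_pow K]; ring
  refine (norm_sum_le_of_le _ b).trans ?_
  rw [sum_const, card_range, nsmul_eq_mul, mul_comm]
  push_cast
  gcongr
  nlinarith

theorem norm_shift_pow_le {K R : ℝ} (hK : 0 ≤ K) (hR : 1 ≤ R) {g : ℕ → F}
    (hg : ∀ n, ‖g n‖ ≤ K * R ^ n) (p n : ℕ) : ‖(shift ^ p) g n‖ ≤ K * R ^ n := by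
  induction p generalizing n with
  | zero => exact hg n
  | succ p ih =>
    rw [pow_succ', Module.End.mul_apply]
    cases n with
    | zero => simpa using hK
    | succ n =>
      rw [shift_succ]
      refine (ih n).trans ?_
      gcongr
      exact Nat.le_succ n

/-- The `q!` allowed in the coefficients is cancelled by the `1 / q!` of `b ^ q`, and the powers of
`a` cost nothing. Only degrees up to `n` contribute at index `n`, which leaves a quadratic factor.
-/
theorem isConvergent_rep (T : ConvAB) {g : ℕ → F} (hg : IsConvergent g) :
    IsConvergent (S.rep T g) := by
  obtain ⟨Q, hQ, A, hA⟩ := bounded_coeffs T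
  have hA0 : 0 ≤ A := by simpa using (norm_nonneg _).trans (hA 0 0)
  have h0 := S.m_nonneg
  have h1 := S.one_le_r
  have h2 := S.κ_nonneg
  obtain ⟨R, C, hR, hR1, hC, hg⟩ := hg.exists_ge (S.r * (1 + 2 * S.κ * S.m))
  set K := 2 * S.κ + 1 with hK
  have hK1 : 1 ≤ K := by linarith
  refine isConvergent_of_le (K := Q * K * R) (C := A * C) (by positivity) fun n => ?_
  rw [rep_apply]
  have b : ∀ d ∈ range (n + 1), ‖homog shift S.beta (coeffs T) d g n‖ ≤
      ((n : ℝ) + 1) * (A * C * (Q * K * R) ^ n) := by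
    intro d hd
    have hd' : d ≤ n := by have := mem_range.1 hd; omega
    rw [homog, LinearMap.sum_apply, Finset.sum_apply]
    have b' : ∀ k ∈ antidiagonal d, ‖((coeffs T) k.1 k.2 •
        (shift ^ k.1 * S.beta ^ k.2) : Module.End ℂ (ℕ → F)) g n‖ ≤
        A * C * (Q * K * R) ^ n := by
      intro k hk
      have hk' := Finset.HasAntidiagonal.mem_antidiagonal.1 hk
      rw [LinearMap.smul_apply, Pi.smul_apply, norm_smul, Module.End.mul_apply]
      have hb := norm_shift_pow_le (by positivity) hR1.le
        (S.norm_beta_pow_le hR hC hg k.2) k.1 n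
      calc _ ≤ (A * Q ^ (k.1 + k.2) * k.2 !) * (C * (2 * S.κ) ^ k.2 / k.2 ! * R ^ n) := by
            gcongr
            exact hA _ _
        _ = A * C * Q ^ (k.1 + k.2) * (2 * S.κ) ^ k.2 * R ^ n := by
            have : ((k.2 ! : ℕ) : ℝ) ≠ 0 := by exact_mod_cast Nat.factorial_ne_zero _
            field_simp
        _ ≤ A * C * Q ^ n * K ^ n * R ^ n := by
            have e1 : Q ^ (k.1 + k.2) ≤ Q ^ n := pow_le_pow_right₀ hQ.le (by omega)
            have e2 : (2 * S.κ) ^ k.2 ≤ K ^ n :=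
              (pow_le_pow_left₀ (by positivity) (by linarith) _).trans
                (pow_le_pow_right₀ hK1 (by omega))
            gcongr
        _ = _ := by rw [mul_pow, mul_pow]; ring
    refine (norm_sum_le_of_le _ b').trans ?_
    rw [sum_const, Nat.card_antidiagonal, nsmul_eq_mul]
    push_cast
    gcongr
  refine (norm_sum_le_of_le _ b).trans (le_of_eq ?_)
  rw [sum_const, card_range, nsmul_eq_mul]
  push_cast
  ring

end SimplePoleSystem

/-! ### The system attached to `M`. -/

/-- The restriction of a representation along an injective map of which the image is stable. -/
def restrictRep {R V N : Type*} [Semiring R] [Algebra ℂ R] [AddCommGroup V] [Module ℂ V]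
    [AddCommGroup N] [Module ℂ N] (ρ : R →ₐ[ℂ] Module.End ℂ V) (f : N →ₗ[ℂ] V)
    (hf : Function.Injective f) (ψ : R → N → N) (h : ∀ T x, f (ψ T x) = ρ T (f x)) :
    R →ₐ[ℂ] Module.End ℂ N :=
  AlgHom.ofLinearMap
    { toFun T :=
        { toFun := ψ T
          map_add' x x' := hf (by rw [map_add, h, h, h, map_add, map_add])
          map_smul' c x := hf (by rw [RingHom.id_apply, map_smul, h, h, map_smul, map_smul]) }
      map_add' T T' := LinearMap.ext fun x => hf (by
        change f (ψ _ _) = f (ψ _ _ + ψ _ _)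
        rw [map_add, h, h, h, map_add]
        rfl)
      map_smul' c T := LinearMap.ext fun x => hf (by
        change f (ψ _ _) = f (c • ψ _ _)
        rw [map_smul, h, h, map_smul]
        rfl) }
    (LinearMap.ext fun x => hf (by
      change f (ψ _ _) = f x
      rw [h, map_one]
      rfl))
    (fun T T' => LinearMap.ext fun x => hf (by
      change f (ψ _ _) = f (ψ _ (ψ _ _))
      rw [h, h, h, map_mul]
      rfl))

/-- Common constants for finitely many series. The weight `w` is `1` for entries in `A` and `n!` for
entries in `B`. -/
theorem exists_uniform_growth {ι : Type*} [Finite ι] {g : ι → ℕ → ℝ} {w : ℕ → ℝ}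
    (hw : ∀ n, 0 ≤ w n)
    (h : ∀ i, ∃ R : ℝ, 1 < R ∧ ∃ C : ℝ, ∀ n, g i n ≤ C * R ^ n * w n) :
    ∃ R C : ℝ, 1 < R ∧ 0 ≤ C ∧ ∀ i n, g i n ≤ C * R ^ n * w n := by
  have := Fintype.ofFinite ι
  choose R hR C hC using h
  refine ⟨2 + ∑ i, R i, ∑ i, |C i|, ?_, sum_nonneg fun i _ => abs_nonneg _, fun i n => ?_⟩
  · have : 0 ≤ ∑ i, R i := sum_nonneg fun i _ => by linarith [hR i]
    linarith
  · have h1 : R i ≤ 2 + ∑ i, R i := by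
      have := single_le_sum (f := R) (fun i _ => by linarith [hR i]) (mem_univ i)
      linarith
    have h2 : C i ≤ ∑ i, |C i| :=
      (le_abs_self _).trans (single_le_sum (f := fun i => |C i|) (fun i _ => abs_nonneg _) (mem_univ i))
    have h3 : 0 ≤ R i := by linarith [hR i]
    have h4 : 0 ≤ ∑ i, |C i| := sum_nonneg fun i _ => abs_nonneg _
    have h5 := hw n
    refine (hC i n).trans ?_
    gcongr

variable {p : ℕ}

/-- The coefficient of `s ^ n` in a matrix over `A`. -/
def holCoeff (M : Matrix (Fin p) (Fin p) HolA) (n : ℕ) : Matrix (Fin p) (Fin p) ℂ :=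
  M.map fun f => coeff n (f : ℂ⟦X⟧)

theorem holCoeff_zero (M : Matrix (Fin p) (Fin p) HolA) : holCoeff M 0 = holAtZero M := by
  ext i j
  simp [holCoeff, holAtZero]

theorem norm_vecMul_le {A : Matrix (Fin p) (Fin p) ℂ} {c : ℝ} (hc : 0 ≤ c)
    (h : ∀ i j, ‖A i j‖ ≤ c) (v : Fin p → ℂ) : ‖Matrix.vecMul v A‖ ≤ p * c * ‖v‖ := by
  refine (pi_norm_le_iff_of_nonneg (x := Matrix.vecMul v A) (by positivity)).2 fun j => ?_
  calc ‖Matrix.vecMul v A j‖ ≤ ∑ _i : Fin p, ‖v‖ * c := by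
        refine norm_sum_le_of_le (f := fun i => v i * A i j) _ fun i _ => ?_
        rw [norm_mul]
        gcongr
        exacts [norm_le_pi_norm v i, h i j]
    _ = _ := by simp; ring

/-- Positivity of the eigenvalues excludes `-n`, so each `n + M(0)` is invertible. Row vectors are
used because the basis `e` is a column: row `i` of `M` gives `a e_i`. -/
theorem exists_simplePoleSystem {M : Matrix (Fin p) (Fin p) HolA} (hM : IsGeometricSystem M) :
    ∃ S : SimplePoleSystem (Fin p → ℂ), ∀ n v, S.L n v = Matrix.vecMul v (holCoeff M n) := by
  obtain ⟨r, C, hr, hC, hb⟩ := exists_uniform_growth (ι := Fin p × Fin p)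
    (g := fun k n => ‖coeff n (M k.1 k.2 : ℂ⟦X⟧)‖) (w := fun _ => 1) (fun _ => zero_le_one)
    (fun k => by simp only [mul_one]; exact (M k.1 k.2).2)
  have hL : ∀ n v, ‖Matrix.vecMul v (holCoeff M n)‖ ≤ (p * C) * r ^ n * ‖v‖ := fun n v => by
    refine (norm_vecMul_le (c := C * r ^ n) (by positivity) (fun i j => ?_) v).trans
      (le_of_eq (by ring))
    simpa [holCoeff] using hb (i, j) n
  set N : ℕ → Matrix (Fin p) (Fin p) ℂ := fun n => (n : ℂ) • 1 + holCoeff M 0 with hN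
  have hu : ∀ n, IsUnit (N n) := by
    intro n
    have h : -(n : ℂ) ∉ spectrum ℂ (holAtZero M) := by
      intro h
      obtain ⟨q, hq, e⟩ := hM _ h
      have e' : (-(n : ℚ)) = q := by exact_mod_cast e
      have : (0 : ℚ) ≤ n := Nat.cast_nonneg n
      linarith
    rw [spectrum.notMem_iff, Algebra.algebraMap_eq_smul_one, ← holCoeff_zero] at h
    have e : N n = -(-(n : ℂ) • 1 - holCoeff M 0) := by
      rw [hN, neg_sub, neg_smul, sub_neg_eq_add, add_comm]
    rw [e]
    exact h.neg
  have hdet : ∀ n, IsUnit (N n).det := fun n => (Matrix.isUnit_iff_isUnit_det _).1 (hu n)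
  have eN : ∀ n v, Matrix.vecMul v (N n) = (n : ℂ) • v + Matrix.vecMul v (holCoeff M 0) := by
    intro n v
    rw [hN, Matrix.vecMul_add, Matrix.vecMul_smul, Matrix.vecMul_one]
  have hJ : ∀ n, ∃ c : ℝ, 0 ≤ c ∧ ∀ v, ‖Matrix.vecMul v (N n)⁻¹‖ ≤ c * ‖v‖ := by
    intro n
    refine ⟨p * ∑ i, ∑ j, ‖(N n)⁻¹ i j‖, by positivity, norm_vecMul_le (by positivity) ?_⟩
    intro i j
    refine (single_le_sum (f := fun j => ‖(N n)⁻¹ i j‖) (fun _ _ => norm_nonneg _) (mem_univ j)).trans ?_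
    exact single_le_sum (f := fun i => ∑ j, ‖(N n)⁻¹ i j‖)
      (fun _ _ => sum_nonneg fun _ _ => norm_nonneg _) (mem_univ i)
  choose c hc0 hc using hJ
  set m : ℝ := p * C with hm
  have hm0 : 0 ≤ m := by positivity
  -- For `n ≥ 2 m + 1` one has `n - m ≥ (n + 1) / 2`, so `n ‖w‖ ≤ ‖v‖ + m ‖w‖` gives `‖w‖ ≤ 2 / (n +
  -- 1) ‖v‖`.
  obtain ⟨n₀, hn₀⟩ := exists_nat_ge (2 * m + 1)
  -- The `2` serves for `n ≥ n₀`, the finite sum for the smaller `n`.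
  set κ : ℝ := 2 + ∑ n ∈ range n₀, c n * (n + 1) with hκ
  have hs0 : 0 ≤ ∑ n ∈ range n₀, c n * ((n : ℝ) + 1) :=
    sum_nonneg fun n _ => mul_nonneg (hc0 n) (by positivity)
  have hκ0 : 0 ≤ κ := by linarith
  refine ⟨{ L := fun n => (holCoeff M n).vecMulLinear
            J := fun n => ((N n)⁻¹).vecMulLinear
            J_apply := fun n v => ?_
            apply_J := fun n v => ?_
            m := m
            r := r
            κ := κ
            m_nonneg := hm0
            one_le_r := hr.le
            κ_nonneg := hκ0
            norm_L := hL
            norm_J := fun n v => ?_ }, fun n v => rfl⟩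
  · change Matrix.vecMul ((n : ℂ) • v + Matrix.vecMul v (holCoeff M 0)) (N n)⁻¹ = v
    rw [← eN, Matrix.vecMul_vecMul, Matrix.mul_nonsing_inv _ (hdet n), Matrix.vecMul_one]
  · change (n : ℂ) • Matrix.vecMul v (N n)⁻¹ +
      Matrix.vecMul (Matrix.vecMul v (N n)⁻¹) (holCoeff M 0) = v
    rw [← eN, Matrix.vecMul_vecMul, Matrix.nonsing_inv_mul _ (hdet n), Matrix.vecMul_one]
  · change ‖Matrix.vecMul v (N n)⁻¹‖ ≤ _
    have hn1 : (0 : ℝ) < n + 1 := by positivity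
    rw [div_mul_eq_mul_div, le_div_iff₀ hn1]
    rcases lt_or_ge n n₀ with h | h
    · have h1 : c n * ((n : ℝ) + 1) ≤ κ := by
        have := single_le_sum (f := fun n : ℕ => c n * ((n : ℝ) + 1))
          (fun n _ => mul_nonneg (hc0 n) (by positivity)) (mem_range.2 h)
        linarith
      calc _ ≤ c n * ‖v‖ * (n + 1) := by gcongr; exact hc n v
        _ = (c n * (n + 1)) * ‖v‖ := by ring
        _ ≤ _ := by gcongr
    · set w := Matrix.vecMul v (N n)⁻¹ with hw
      have e : (n : ℂ) • w + Matrix.vecMul w (holCoeff M 0) = v := by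
        rw [← eN, hw, Matrix.vecMul_vecMul, Matrix.nonsing_inv_mul _ (hdet n), Matrix.vecMul_one]
      have h1 : (n : ℝ) * ‖w‖ ≤ ‖v‖ + m * ‖w‖ := by
        have e2 : (n : ℂ) • w = v - Matrix.vecMul w (holCoeff M 0) := by rw [← e]; abel
        have e3 : ‖(n : ℂ) • w‖ = n * ‖w‖ := by rw [norm_smul, Complex.norm_natCast]
        rw [← e3, e2]
        refine (norm_sub_le _ _).trans (add_le_add le_rfl ?_)
        simpa using hL 0 w
      have h2 : (n₀ : ℝ) ≤ n := by exact_mod_cast h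
      have h3 : 0 ≤ ‖w‖ := norm_nonneg w
      have h4 : 0 ≤ ‖v‖ := norm_nonneg v
      calc ‖w‖ * (n + 1) ≤ 2 * ‖v‖ := by nlinarith
        _ ≤ κ * ‖v‖ := by gcongr; linarith

/-! ### Transport of the action from convergent series to `B ^ p`. -/

/-- The coefficients of an element of `B ^ p`. -/
def coeffSeq : (Fin p → GevB) →ₗ[ℂ] (ℕ → Fin p → ℂ) where
  toFun x n i := coeff n (x i : ℂ⟦X⟧)
  map_add' x y := by funext n i; simp
  map_smul' c x := by funext n i; simp

theorem coeffSeq_apply (x : Fin p → GevB) (n : ℕ) (i : Fin p) :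
    coeffSeq x n i = coeff n (x i : ℂ⟦X⟧) := rfl

theorem coeffSeq_injective : Function.Injective (coeffSeq (p := p)) := by
  intro x y h
  funext i
  apply Subtype.ext
  ext n
  exact congrFun (congrFun h n) i

theorem isGevrey_coeffSeq (x : Fin p → GevB) : IsGevrey (coeffSeq x) := by
  obtain ⟨R, C, hR, hC, h⟩ := exists_uniform_growth
    (g := fun i n => ‖coeff n (x i : ℂ⟦X⟧)‖) (w := fun n => n !) (fun n => by positivity) (fun i => (x i).2)
  exact ⟨R, hR, C, fun n => (pi_norm_le_iff_of_nonneg (by positivity)).2 fun i => h i n⟩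

theorem exists_coeffSeq_eq {u : ℕ → Fin p → ℂ} (hu : IsGevrey u) :
    ∃ x : Fin p → GevB, coeffSeq x = u := by
  obtain ⟨R, hR, C, h⟩ := hu
  refine ⟨fun i => ⟨PowerSeries.mk fun n => u n i, R, hR, C, fun n => ?_⟩, ?_⟩
  · rw [coeff_mk]
    exact (norm_le_pi_norm (u n) i).trans (h n)
  · funext n i
    rw [coeffSeq_apply, coeff_mk]

theorem coeffSeq_smul (f : GevB) (x : Fin p → GevB) :
    coeffSeq (f • x) = fun n => ∑ k ∈ antidiagonal n, coeff k.1 (f : ℂ⟦X⟧) • coeffSeq x k.2 := by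
  funext n i
  rw [coeffSeq_apply, Finset.sum_apply]
  simp only [Pi.smul_apply, smul_eq_mul, MulMemClass.coe_mul, coeff_mul]
  rfl

theorem coeffSeq_single (i : Fin p) :
    coeffSeq (Pi.single i (1 : GevB)) = constSeq (Pi.single i (1 : ℂ)) := by
  funext n j
  rw [coeffSeq_apply, constSeq]
  rcases eq_or_ne j i with rfl | h
  · simp only [Pi.single_eq_same, OneMemClass.coe_one, coeff_one]
    split_ifs <;> simp
  · rw [Pi.single_eq_of_ne h]
    split_ifs <;> simp [h]

namespace SimplePoleSystem

variable (S : SimplePoleSystem (Fin p → ℂ))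

/-- The realization of `B ^ p` as a space of convergent series. -/
def realize : (Fin p → GevB) →ₗ[ℂ] (ℕ → Fin p → ℂ) := S.expand ∘ₗ coeffSeq

theorem realize_injective : Function.Injective S.realize :=
  S.expand_injective.comp coeffSeq_injective

theorem isConvergent_realize (x : Fin p → GevB) : IsConvergent (S.realize x) :=
  S.isConvergent_expand (isGevrey_coeffSeq x)

/-- The digits of a convergent series are Gevrey, hence are the coefficients of an element of `B ^
p`. -/
theorem exists_realize_eq {g : ℕ → Fin p → ℂ} (hg : IsConvergent g) : ∃ x, S.realize x = g := by
  obtain ⟨x, hx⟩ := exists_coeffSeq_eq (S.isGevrey_digits hg)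
  exact ⟨x, by rw [realize, LinearMap.comp_apply, hx, S.expand_digits]⟩

theorem realize_stable (T : ConvAB) (x : Fin p → GevB) :
    ∃ y, S.realize y = S.rep T (S.realize x) :=
  S.exists_realize_eq (S.isConvergent_rep T (S.isConvergent_realize x))

/-- The convergent (a,b)-module of a system. -/
def toGBM : GBM p where
  act := restrictRep S.rep S.realize S.realize_injective
    (fun T x => (S.realize_stable T x).choose) fun T x => (S.realize_stable T x).choose_spec
  act_ofB f x := S.realize_injective (by
    refine (S.realize_stable (ofB f) x).choose_spec.trans ?_
    rw [realize, LinearMap.comp_apply, LinearMap.comp_apply, rep_ofB_expand, coeffSeq_smul])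

theorem realize_act (T : ConvAB) (x : Fin p → GevB) :
    S.realize (S.toGBM.act T x) = S.rep T (S.realize x) :=
  (S.realize_stable T x).choose_spec

/-- `s g = b (D g)`, and `D` preserves convergence. -/
theorem isSimplePole_toGBM : S.toGBM.IsSimplePole := by
  intro x
  obtain ⟨y, hy⟩ := S.exists_realize_eq (S.isConvergent_D (S.isConvergent_realize x))
  refine ⟨y, S.realize_injective ?_⟩
  rw [realize_act, realize_act, rep_aOp, rep_bOp, hy, beta_D]

theorem realize_single (i : Fin p) :
    S.realize (Pi.single i 1) = S.gen (Pi.single i 1) := by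
  rw [realize, LinearMap.comp_apply, coeffSeq_single, expand_apply,
    formalSum_eq_single (fun q => S.beta_pow_mem_fil _ q) 0]
  · simp [constSeq]
  · intro d hd
    simp [constSeq, hd]

theorem shift_pow_shift_constSeq (v : Fin p → ℂ) (d n : ℕ) :
    (shift ^ d) (shift (constSeq v)) n = if n = d + 1 then v else 0 := by
  induction d generalizing n with
  | zero => cases n <;> simp [constSeq]
  | succ d ih =>
    rw [pow_succ', Module.End.mul_apply]
    cases n with
    | zero => simp
    | succ n => rw [shift_succ, ih]; simp

/-- Both sides are `s` times the series of row `i` of `M`: on the left `s D(constant)`, on the right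
the functions `M_ij(s)` applied to `b e_j = s · constant`. -/
theorem hasHolMatrix_toGBM {M : Matrix (Fin p) (Fin p) HolA}
    (hS : ∀ n v, S.L n v = Matrix.vecMul v (holCoeff M n)) : S.toGBM.HasHolMatrix M := by
  intro i
  refine S.realize_injective ?_
  rw [map_sum, realize_act, rep_aOp, realize_single]
  simp only [realize_act, rep_bOp, realize_single, beta_gen, rep_ofA]
  funext n
  rw [Finset.sum_apply]
  simp only [formalSum, Pi.smul_apply, shift_pow_shift_constSeq]
  cases n with
  | zero => simp
  | succ n =>
    rw [shift_succ, gen_apply, hS]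
    funext k
    rw [Finset.sum_apply, Matrix.single_one_vecMul]
    simp [holCoeff, ite_apply, Pi.single_apply]

end SimplePoleSystem

/-! ### Division by `a` and by `b` in the convergent algebra. -/

theorem ofA_eq_add_aOp_mul (f : HolA) :
    ∃ (c : ℂ) (g : HolA), c = constantCoeff (f : ℂ⟦X⟧) ∧
      ofA f = algebraMap ℂ ConvAB c + aOp * ofA g := by
  obtain ⟨R, hR, C, hf⟩ := f.2
  refine ⟨_, ⟨PowerSeries.mk fun n => coeff (n + 1) (f : ℂ⟦X⟧), R, hR, C * R, fun n => ?_⟩, rfl, ?_⟩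
  · rw [coeff_mk]
    exact (hf (n + 1)).trans (le_of_eq (by ring))
  · apply Subtype.ext
    refine LinearMap.ext fun h => ?_
    change op (fromA f) h = constantCoeff (f : ℂ⟦X⟧) • h + (op (fromA X)) (op (fromA _) h)
    rw [op_fromA, op_fromA, op_fromA, ← mul_assoc]
    conv_lhs => rw [eq_X_mul_shift_add_const (f : ℂ⟦X⟧)]
    rw [add_mul, add_comm, smul_eq_C_mul]

theorem coeff_op_bOp (x : ℕ → ℕ → ℂ) (f : ℂ⟦X⟧) (m : ℕ) :
    coeff (m + 1) (op x ((bOp : Module.End ℂ ℂ⟦X⟧) f)) =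
      ∑ k ∈ antidiagonal m, ∑ u ∈ antidiagonal k.1,
        x u.1 u.2 * ((k.2 ! : ℂ) / ((u.2 + 1 + k.2)! : ℂ)) * coeff k.2 f := by
  rw [coeff_op, Nat.sum_antidiagonal_succ']
  simp only [coeff_zero_bOp_apply, mul_zero, sum_const_zero, zero_add, coeff_bOp_apply]
  refine sum_congr rfl fun k _ => sum_congr rfl fun u _ => ?_
  rw [Nat.factorial_succ k.2, show u.2 + (k.2 + 1) = u.2 + 1 + k.2 by ring]
  have h : ((k.2 : ℂ) + 1) ≠ 0 := by exact_mod_cast Nat.succ_ne_zero k.2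
  push_cast
  field_simp

theorem coeff_zero_op_bOp (x : ℕ → ℕ → ℂ) (f : ℂ⟦X⟧) :
    coeff 0 (op x ((bOp : Module.End ℂ ℂ⟦X⟧) f)) = 0 := by
  have h : constantCoeff ((bOp : Module.End ℂ ℂ⟦X⟧) f) = 0 := by
    simpa using coeff_zero_bOp_apply f
  simp [coeff_op, h]

/-- In normal form the terms with `q = 0` make `f(a)` and all others end with `b`. Removing that `b`
keeps the growth condition, as `(q + 1)! ≤ 2 ^ (p + q) q!`. -/
theorem exists_eq_ofA_add_mul_bOp (T : ConvAB) :
    ∃ (f : HolA) (T' : ConvAB), T = ofA f + T' * bOp := by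
  obtain ⟨T, x, hx, rfl⟩ := T
  obtain ⟨R, hR, C, hx⟩ := hx
  have hC : 0 ≤ C := by simpa using (norm_nonneg _).trans (hx 0 0)
  have hb : Bounded fun p q => x p (q + 1) := by
    refine ⟨2 * R, by linarith, C * R, fun p q => (hx p (q + 1)).trans ?_⟩
    have h : ((q : ℝ) + 1) ≤ 2 ^ (p + q) := by
      have h1 : q + 1 ≤ 2 ^ (p + q) :=
        (Nat.lt_two_pow_self (n := q)).trans_le (Nat.pow_le_pow_right (by norm_num) (by omega))
      exact_mod_cast h1
    rw [Nat.factorial_succ]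
    push_cast
    calc _ = C * R * (((q : ℝ) + 1) * R ^ (p + q)) * q ! := by ring
      _ ≤ C * R * (2 ^ (p + q) * R ^ (p + q)) * q ! := by gcongr
      _ = _ := by rw [mul_pow]
  refine ⟨⟨PowerSeries.mk fun n => x n 0, R, hR, C, fun n => by simpa using hx n 0⟩,
    ⟨op _, _, hb, rfl⟩, Subtype.ext (LinearMap.ext fun f => ?_)⟩
  change op x f = op (fromA _) f + op (fun p q => x p (q + 1)) ((bOp : Module.End ℂ ℂ⟦X⟧) f)
  set g : ℂ⟦X⟧ := PowerSeries.mk fun n => x n 0 with hg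
  have hx' : x = fromA g + fun p q => if q = 0 then 0 else x p q := by
    funext p q
    by_cases h : q = 0
    · subst h; simp [fromA, hg]
    · simp [fromA, h]
  have hop : op x = op (fromA g) + op (fun p q => if q = 0 then 0 else x p q) := by
    rw [op_add_op, ← hx']
  rw [hop, LinearMap.add_apply]
  congr 1
  ext m
  cases m with
  | zero =>
    rw [coeff_zero_op_bOp, coeff_op]
    simp
  | succ m =>
    rw [coeff_op_bOp, coeff_op, Nat.sum_antidiagonal_succ]
    simp only [Nat.sum_antidiagonal_succ', Finset.Nat.antidiagonal_zero, sum_singleton]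
    simp

/-- This is `a ^ p b = b (a ^ p + p a ^ (p - 1) b)` on coefficients. After reindexing, the second
summand contributes `u.1` and the first `u.2 + k + 1`; the total `n + k + 1` is constant on the
antidiagonal and undoes one integration. -/
theorem sum_antidiagonal_succ_mul (x : ℕ → ℕ → ℂ) (n k : ℕ) :
    ∑ u ∈ antidiagonal n, (x u.1 u.2 + if u.2 = 0 then 0 else ((u.1 : ℂ) + 1) * x (u.1 + 1) (u.2 - 1)) *
      ((k ! : ℂ) / ((u.2 + k)! : ℂ)) =
    ((n : ℂ) + k + 1) * ∑ u ∈ antidiagonal n, x u.1 u.2 * ((k ! : ℂ) / ((u.2 + 1 + k)! : ℂ)) := by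
  have h1 : ∑ u ∈ antidiagonal n, (if u.2 = 0 then 0 else ((u.1 : ℂ) + 1) * x (u.1 + 1) (u.2 - 1)) *
      ((k ! : ℂ) / ((u.2 + k)! : ℂ)) =
      ∑ u ∈ antidiagonal n, (u.1 : ℂ) * x u.1 u.2 * ((k ! : ℂ) / ((u.2 + 1 + k)! : ℂ)) := by
    cases n with
    | zero => simp
    | succ n =>
      rw [Nat.sum_antidiagonal_succ', Nat.sum_antidiagonal_succ]
      simp
  rw [sum_congr rfl fun u _ => add_mul _ _ _, sum_add_distrib, h1, ← sum_add_distrib, mul_sum]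
  refine sum_congr rfl fun u hu => ?_
  rw [← Finset.HasAntidiagonal.mem_antidiagonal.1 hu, show u.2 + 1 + k = (u.2 + k) + 1 by ring,
    Nat.factorial_succ (u.2 + k)]
  have h2 : ((u.2 + k)! : ℂ) ≠ 0 := by exact_mod_cast Nat.factorial_ne_zero _
  have h3 : ((u.2 : ℂ) + k + 1) ≠ 0 := by exact_mod_cast Nat.succ_ne_zero (u.2 + k)
  push_cast
  field_simp
  ring

/-- The coefficients `u` with `(∑ x_{p,q} a ^ p b ^ q) b = b ∑ u_{p,q} a ^ p b ^ q`. -/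
def conjCoeff (x : ℕ → ℕ → ℂ) (p q : ℕ) : ℂ :=
  x p q + if q = 0 then 0 else ((p : ℂ) + 1) * x (p + 1) (q - 1)

theorem Bounded.conjCoeff {x : ℕ → ℕ → ℂ} (hx : Bounded x) : Bounded (conjCoeff x) := by
  obtain ⟨R, hR, C, hx⟩ := hx
  have hC : 0 ≤ C := by simpa using (norm_nonneg _).trans (hx 0 0)
  refine ⟨2 * R, by linarith, 2 * C, fun p q => ?_⟩
  have b1 : ‖x p q‖ ≤ C * (2 * R) ^ (p + q) * q ! := by
    refine (hx p q).trans ?_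
    gcongr
    linarith
  have b2 : ‖if q = 0 then (0 : ℂ) else ((p : ℂ) + 1) * x (p + 1) (q - 1)‖ ≤
      C * (2 * R) ^ (p + q) * q ! := by
    cases q with
    | zero =>
      rw [if_pos rfl, norm_zero]
      positivity
    | succ q =>
      rw [if_neg (Nat.succ_ne_zero q), norm_mul, Nat.add_sub_cancel]
      have h1 : ‖(p : ℂ) + 1‖ ≤ 2 ^ (p + (q + 1)) := by
        have h2 : p + 1 ≤ 2 ^ (p + (q + 1)) :=
          (Nat.lt_two_pow_self (n := p)).trans_le (Nat.pow_le_pow_right (by norm_num) (by omega))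
        have h3 : ‖(p : ℂ) + 1‖ = ((p + 1 : ℕ) : ℝ) := by
          rw [← Complex.norm_natCast, Nat.cast_succ]
        rw [h3]
        exact_mod_cast h2
      have h4 : ((q ! : ℕ) : ℝ) ≤ (q + 1)! := by
        exact_mod_cast Nat.factorial_le (Nat.le_succ q)
      calc ‖(p : ℂ) + 1‖ * ‖x (p + 1) q‖
          ≤ 2 ^ (p + (q + 1)) * (C * R ^ (p + 1 + q) * q !) := by
            gcongr
            exact hx _ _
        _ ≤ 2 ^ (p + (q + 1)) * (C * R ^ (p + 1 + q) * (q + 1)!) := by gcongr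
        _ = C * (2 * R) ^ (p + (q + 1)) * (q + 1)! := by
            rw [mul_pow, show p + 1 + q = p + (q + 1) by ring]
            ring
  calc ‖ABModule.conjCoeff x p q‖ ≤ C * (2 * R) ^ (p + q) * q ! + C * (2 * R) ^ (p + q) * q ! :=
        (norm_add_le _ _).trans (add_le_add b1 b2)
    _ = _ := by ring

theorem op_bOp_eq (x : ℕ → ℕ → ℂ) (f : ℂ⟦X⟧) :
    op x ((bOp : Module.End ℂ ℂ⟦X⟧) f) = (bOp : Module.End ℂ ℂ⟦X⟧) (op (conjCoeff x) f) := by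
  ext m
  cases m with
  | zero => rw [coeff_zero_op_bOp, coeff_zero_bOp_apply]
  | succ m =>
    have h : (m : ℂ) + 1 ≠ 0 := by exact_mod_cast Nat.succ_ne_zero m
    rw [coeff_op_bOp, coeff_bOp_apply, coeff_op, eq_div_iff h, sum_mul]
    refine sum_congr rfl fun k hk => ?_
    simp only [conjCoeff]
    rw [← sum_mul, ← sum_mul, sum_antidiagonal_succ_mul,
      ← Finset.HasAntidiagonal.mem_antidiagonal.1 hk, Nat.cast_add]
    ring

/-- Every element of the algebra can be moved across `b`; this makes `b E` stable under the whole
algebra. -/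
theorem exists_mul_bOp_eq (T : ConvAB) : ∃ U : ConvAB, T * bOp = bOp * U := by
  obtain ⟨T, x, hx, rfl⟩ := T
  exact ⟨⟨op (conjCoeff x), _, hx.conjCoeff, rfl⟩, Subtype.ext (LinearMap.ext (op_bOp_eq x))⟩

/-! ### The `b`-adic filtration and uniqueness. -/

/-- The submodule `b ^ N B ^ p`. -/
def bFil (p N : ℕ) : Submodule GevB (Fin p → GevB) where
  carrier := {y | ∃ z, b ^ N • z = y}
  add_mem' := by
    rintro _ _ ⟨z, rfl⟩ ⟨z', rfl⟩
    exact ⟨z + z', smul_add _ _ _⟩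
  zero_mem' := ⟨0, smul_zero _⟩
  smul_mem' := by
    rintro c _ ⟨z, rfl⟩
    exact ⟨c • z, smul_comm _ _ _⟩

theorem mem_bFil_zero {p : ℕ} (y : Fin p → GevB) : y ∈ bFil p 0 := ⟨y, by simp⟩

theorem bFil_anti {p N N' : ℕ} (h : N ≤ N') : bFil p N' ≤ bFil p N := by
  rintro _ ⟨z, rfl⟩
  refine ⟨b ^ (N' - N) • z, ?_⟩
  rw [smul_smul, ← pow_add, Nat.add_sub_cancel' h]

theorem b_smul_mem_bFil {p N : ℕ} {y : Fin p → GevB} (h : y ∈ bFil p N) :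
    b • y ∈ bFil p (N + 1) := by
  obtain ⟨z, rfl⟩ := h
  exact ⟨z, by rw [smul_smul, pow_succ']⟩

theorem coe_b_pow_mul (N : ℕ) (S : GevB) : ((b ^ N * S : GevB) : ℂ⟦X⟧) = X ^ N * (S : ℂ⟦X⟧) := rfl

theorem eq_zero_of_forall_mem_bFil {p : ℕ} {y : Fin p → GevB} (h : ∀ N, y ∈ bFil p N) : y = 0 := by
  funext i
  apply Subtype.ext
  ext n
  obtain ⟨z, rfl⟩ := h (n + 1)
  change coeff n ((b ^ (n + 1) * z i : GevB) : ℂ⟦X⟧) = _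
  rw [coe_b_pow_mul, coeff_X_pow_mul', if_neg (by omega)]
  simp

theorem theta_b : theta b = b := by
  apply Subtype.ext
  ext n
  change coeff n (PowerSeries.mk fun n => (n : ℂ) * coeff n (X : ℂ⟦X⟧)) = coeff n X
  rw [coeff_mk, coeff_X]
  split_ifs with h
  · subst h; simp
  · simp

namespace GBM

variable (E E' : GBM p)

theorem act_bOp (x : Fin p → GevB) : E.act bOp x = b • x := E.act_ofB b x

theorem act_mul (T T' : ConvAB) (x : Fin p → GevB) :
    E.act (T * T') x = E.act T (E.act T' x) := by
  rw [map_mul]; rfl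

/-- From `a b = b a + b ^ 2`, the gain of one power of `b` on `E` propagates to every `b ^ N E`. -/
theorem act_aOp_mem_bFil (hE : E.IsSimplePole) (N : ℕ) {y : Fin p → GevB} (hy : y ∈ bFil p N) :
    E.act aOp y ∈ bFil p (N + 1) := by
  induction N generalizing y with
  | zero =>
    obtain ⟨z, hz⟩ := hE y
    rw [hz, act_bOp]
    exact b_smul_mem_bFil (mem_bFil_zero z)
  | succ N ih =>
    obtain ⟨z, rfl⟩ := hy
    rw [pow_succ', mul_smul, act_a_smul, theta_b]
    refine add_mem (b_smul_mem_bFil (ih ⟨z, rfl⟩)) ?_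
    rw [mul_smul]
    exact b_smul_mem_bFil (b_smul_mem_bFil ⟨z, rfl⟩)

theorem exists_act_b_smul (T : ConvAB) (y : Fin p → GevB) : ∃ z, E.act T (b • y) = b • z := by
  obtain ⟨U, hU⟩ := exists_mul_bOp_eq T
  exact ⟨E.act U y, by rw [← act_bOp, ← act_mul, hU, act_mul, act_bOp]⟩

/-- Writing `f(a) = c + a g(a)`, the difference splits into `(a - a')(b z) = b (a - a') z`, of order
`N + 1`, and `a'` applied to the same difference for `g`. Repeating this `K` times pushes the latter
beyond order `K`. -/
theorem act_ofA_sub_mem (hE' : E'.IsSimplePole) {N : ℕ}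
    (h : ∀ x, E.act aOp x - E'.act aOp x ∈ bFil p N) (K : ℕ) (f : HolA) (y : Fin p → GevB) :
    E.act (ofA f) (b • y) - E'.act (ofA f) (b • y) ∈ bFil p (min (N + 1) K) := by
  induction K generalizing f with
  | zero => simpa using mem_bFil_zero _
  | succ K ih =>
    obtain ⟨c, g, -, hg⟩ := ofA_eq_add_aOp_mul f
    obtain ⟨z, hz⟩ := E.exists_act_b_smul (ofA g) y
    have e : E.act (ofA f) (b • y) - E'.act (ofA f) (b • y) =
        b • (E.act aOp z - E'.act aOp z) +
          E'.act aOp (E.act (ofA g) (b • y) - E'.act (ofA g) (b • y)) := by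
      rw [hg, map_add, map_add, AlgHom.commutes, AlgHom.commutes, LinearMap.add_apply,
        LinearMap.add_apply, act_mul, act_mul, map_sub, hz, act_a_smul, act_a_smul, smul_sub]
      abel
    rw [e]
    refine add_mem (bFil_anti (min_le_left _ _) (b_smul_mem_bFil (h z))) ?_
    exact bFil_anti (by omega) (E'.act_aOp_mem_bFil hE' _ (ih g))

theorem eq_sum_single (x : Fin p → GevB) : x = ∑ i, x i • Pi.single i (1 : GevB) := by
  funext j
  rw [Finset.sum_apply]
  simp [Pi.single_apply]

/-- The Leibniz terms cancel in `a - a'`, which is therefore `B`-linear and determined on the basis.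
There the common relation `a e = M(a) b e` supplies one more power of `b`, and `B ^ p` is
`b`-adically separated. -/
theorem act_aOp_eq {M : Matrix (Fin p) (Fin p) HolA} (hE' : E'.IsSimplePole)
    (hM : E.HasHolMatrix M) (hM' : E'.HasHolMatrix M) : E.act aOp = E'.act aOp := by
  have key : ∀ N x, E.act aOp x - E'.act aOp x ∈ bFil p N := by
    intro N
    induction N with
    | zero => exact fun x => mem_bFil_zero _
    | succ N ih =>
      intro x
      have e : E.act aOp x - E'.act aOp x = ∑ i, x i • (E.act aOp (Pi.single i 1) -
          E'.act aOp (Pi.single i 1)) := by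
        conv_lhs => rw [eq_sum_single x]
        rw [map_sum, map_sum, ← sum_sub_distrib]
        refine sum_congr rfl fun i _ => ?_
        rw [act_a_smul, act_a_smul, smul_sub]
        abel
      rw [e]
      refine sum_mem fun i _ => Submodule.smul_mem _ _ ?_
      rw [hM i, hM' i, ← sum_sub_distrib]
      refine sum_mem fun j _ => ?_
      rw [act_bOp, act_bOp]
      simpa using E.act_ofA_sub_mem E' hE' ih (N + 1) (M i j) (Pi.single j 1)
  exact LinearMap.ext fun x => sub_eq_zero.1 (eq_zero_of_forall_mem_bFil fun N => key N x)

/-- Since no continuity of the action is assumed, series are reached by division: `f(a) = c + a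
g(a)` settles `A`, as `a'` raises the order, and then `T = f(a) + b U` settles all of the algebra.
-/
theorem ext_of_act_aOp (hE' : E'.IsSimplePole) (h : E.act aOp = E'.act aOp) : E = E' := by
  have hA : ∀ N (f : HolA) x, E.act (ofA f) x - E'.act (ofA f) x ∈ bFil p N := by
    intro N
    induction N with
    | zero => exact fun f x => mem_bFil_zero _
    | succ N ih =>
      intro f x
      obtain ⟨c, g, -, hg⟩ := ofA_eq_add_aOp_mul f
      have e : E.act (ofA f) x - E'.act (ofA f) x =
          E'.act aOp (E.act (ofA g) x - E'.act (ofA g) x) := by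
        rw [hg, map_add, map_add, AlgHom.commutes, AlgHom.commutes, LinearMap.add_apply,
          LinearMap.add_apply, act_mul, act_mul, map_sub, h]
        abel
      rw [e]
      exact E'.act_aOp_mem_bFil hE' _ (ih g x)
  have hT : ∀ N (T : ConvAB) x, E.act T x - E'.act T x ∈ bFil p N := by
    intro N
    induction N with
    | zero => exact fun T x => mem_bFil_zero _
    | succ N ih =>
      intro T x
      obtain ⟨f, T', rfl⟩ := exists_eq_ofA_add_mul_bOp T
      obtain ⟨U, hU⟩ := exists_mul_bOp_eq T'
      have e : E.act (ofA f + T' * bOp) x - E'.act (ofA f + T' * bOp) x =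
          (E.act (ofA f) x - E'.act (ofA f) x) + b • (E.act U x - E'.act U x) := by
        rw [hU, map_add, map_add, LinearMap.add_apply, LinearMap.add_apply, act_mul, act_mul,
          act_bOp, act_bOp, smul_sub]
        abel
      rw [e]
      exact add_mem (hA _ f x) (b_smul_mem_bFil (ih U x))
  refine GBM.ext (AlgHom.ext fun T => LinearMap.ext fun x => ?_)
  exact sub_eq_zero.1 (eq_zero_of_forall_mem_bFil fun N => hT N T x)

end GBM

/-! ### Values at `0`, the saturation and the Bernstein polynomial. -/

theorem minpoly_eq_of_aeval_eq_zero_iff {R R' : Type*} [Ring R] [Algebra ℂ R] [Ring R'] [Algebra ℂ R']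
    {x : R} {y : R'} (hx : IsIntegral ℂ x) (hy : IsIntegral ℂ y)
    (h : ∀ P : Polynomial ℂ, Polynomial.aeval x P = 0 ↔ Polynomial.aeval y P = 0) :
    minpoly ℂ x = minpoly ℂ y :=
  Polynomial.eq_of_monic_of_associated (minpoly.monic hx) (minpoly.monic hy)
    (associated_of_dvd_dvd (minpoly.dvd _ _ ((h _).2 (minpoly.aeval _ _)))
      (minpoly.dvd _ _ ((h _).1 (minpoly.aeval _ _))))

theorem minpoly_transpose {n : Type*} [Fintype n] [DecidableEq n] (A : Matrix n n ℂ) :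
    minpoly ℂ A.transpose = minpoly ℂ A := by
  refine minpoly_eq_of_aeval_eq_zero_iff (Matrix.isIntegral _) (Matrix.isIntegral _) fun P => ?_
  have h : Polynomial.aeval A.transpose P = (Polynomial.aeval A P).transpose := by
    simp [Polynomial.aeval_eq_sum_range, Matrix.transpose_sum, Matrix.transpose_pow]
  rw [h, Matrix.transpose_eq_zero]

theorem minpoly_vecMulLinear {n : Type*} [Fintype n] [DecidableEq n] (A : Matrix n n ℂ) :
    minpoly ℂ (A.vecMulLinear : Module.End ℂ (n → ℂ)) = minpoly ℂ A := by
  have h : (A.vecMulLinear : Module.End ℂ (n → ℂ)) = Matrix.toLin' A.transpose := by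
    refine LinearMap.ext fun v => ?_
    rw [Matrix.toLin'_apply, Matrix.mulVec_transpose]
    rfl
  rw [h, Matrix.minpoly_toLin', minpoly_transpose]

/-- The value at `0` of an element of `B ^ p`. -/
def valueAtZero (p : ℕ) : (Fin p → GevB) →ₗ[ℂ] (Fin p → ℂ) where
  toFun x i := constantCoeff (x i : ℂ⟦X⟧)
  map_add' x y := by funext i; simp
  map_smul' c x := by funext i; simp

theorem valueAtZero_smul (f : GevB) (x : Fin p → GevB) :
    valueAtZero p (f • x) = constantCoeff (f : ℂ⟦X⟧) • valueAtZero p x := by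
  funext i
  simp [valueAtZero]

theorem constantCoeff_b : constantCoeff (b : ℂ⟦X⟧) = 0 := constantCoeff_X

theorem constantCoeff_theta (f : GevB) : constantCoeff (theta f : ℂ⟦X⟧) = 0 := by
  simp [theta]

theorem valueAtZero_single (i : Fin p) :
    valueAtZero p (Pi.single i 1) = Pi.single i 1 := by
  funext j
  rcases eq_or_ne j i with rfl | h
  · simp [valueAtZero]
  · simp [valueAtZero, h]

theorem valueAtZero_surjective : Function.Surjective (valueAtZero p) := by
  intro v
  refine ⟨fun i => algebraMap ℂ GevB (v i), funext fun i => ?_⟩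
  change constantCoeff (algebraMap ℂ ℂ⟦X⟧ (v i)) = v i
  simp

theorem valueAtZero_eq_zero_iff {x : Fin p → GevB} :
    valueAtZero p x = 0 ↔ ∃ y, x = b • y := by
  constructor
  · intro h
    have h' : ∀ i, ∃ y : GevB, x i = b * y := by
      intro i
      obtain ⟨R, hR, C, hx⟩ := (x i).2
      have hC : 0 ≤ C := by simpa using (norm_nonneg _).trans (hx 0)
      refine ⟨⟨PowerSeries.mk fun n => coeff (n + 1) (x i : ℂ⟦X⟧), 2 * R, by linarith, C * R,
        fun n => ?_⟩, ?_⟩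
      · have h2 : ((n : ℝ) + 1) ≤ 2 ^ n := by exact_mod_cast Nat.lt_two_pow_self
        rw [coeff_mk]
        refine (hx (n + 1)).trans ?_
        rw [Nat.factorial_succ]
        push_cast
        calc _ = C * R * (((n : ℝ) + 1) * R ^ n) * n ! := by ring
          _ ≤ C * R * (2 ^ n * R ^ n) * n ! := by gcongr
          _ = _ := by rw [mul_pow]
      · apply Subtype.ext
        change (x i : ℂ⟦X⟧) = X * PowerSeries.mk fun n => coeff (n + 1) (x i : ℂ⟦X⟧)
        have h0 : constantCoeff (x i : ℂ⟦X⟧) = 0 := congrFun h i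
        conv_lhs => rw [eq_X_mul_shift_add_const (x i : ℂ⟦X⟧), h0, map_zero, add_zero]
    choose y hy using h'
    exact ⟨y, funext hy⟩
  · rintro ⟨y, rfl⟩
    rw [valueAtZero_smul, constantCoeff_b, zero_smul]

theorem b_ne_zero : b ≠ 0 := fun h => X_ne_zero (congrArg Subtype.val h)

theorem smul_pi_injective {f : GevB} (hf : f ≠ 0) :
    Function.Injective fun x : Fin p → GevB => f • x := by
  intro x y h
  funext i
  exact mul_left_cancel₀ hf (congrFun h i)

namespace GBM

variable (E : GBM p)

theorem hasGevMatrix_iff (Y : Matrix (Fin p) (Fin p) GevB) :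
    E.HasGevMatrix Y ↔ ∀ i, E.act aOp (Pi.single i 1) = b • Y i := by
  refine forall_congr' fun i => ?_
  have : ∑ j, Y i j • E.act bOp (Pi.single j 1) = b • Y i := by
    conv_rhs => rw [eq_sum_single (Y i)]
    rw [smul_sum]
    refine sum_congr rfl fun j _ => ?_
    rw [act_bOp, smul_comm]
  rw [this]

theorem existsUnique_hasGevMatrix (hE : E.IsSimplePole) :
    ∃! Y : Matrix (Fin p) (Fin p) GevB, E.HasGevMatrix Y := by
  choose Y hY using fun i => hE (Pi.single i 1)
  refine ⟨Y, (E.hasGevMatrix_iff Y).2 fun i => by rw [hY, act_bOp], fun Y' hY' => ?_⟩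
  funext i
  refine smul_pi_injective b_ne_zero ?_
  change b • Y' i = b • Y i
  rw [← (E.hasGevMatrix_iff Y').1 hY' i, hY, act_bOp]

theorem gevAtZero_eq (hE : E.IsSimplePole) {M : Matrix (Fin p) (Fin p) HolA}
    (hM : E.HasHolMatrix M) {Y : Matrix (Fin p) (Fin p) GevB} (hY : E.HasGevMatrix Y) :
    gevAtZero Y = holAtZero M := by
  have key : ∀ (f : HolA) (y : Fin p → GevB), ∃ w,
      E.act (ofA f) (b • y) = b • (constantCoeff (f : ℂ⟦X⟧) • y + b • w) := by
    intro f y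
    obtain ⟨c, g, hc, hg⟩ := ofA_eq_add_aOp_mul f
    obtain ⟨z, hz⟩ := E.exists_act_b_smul (ofA g) y
    -- The part `a g(a) (b y)` falls into `b ^ 2 E`, so only `f(0)` survives after division by `b`
    -- and reduction modulo `b`.
    obtain ⟨w, hw⟩ := E.act_aOp_mem_bFil hE 1 (y := b • z) ⟨z, by rw [pow_one]⟩
    refine ⟨w, ?_⟩
    rw [hg, map_add, AlgHom.commutes, LinearMap.add_apply, act_mul, hz, ← hw, hc, smul_add,
      Module.algebraMap_end_apply, smul_comm, smul_smul, pow_two]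
  choose w hw using key
  ext i k
  have h1 := (E.hasGevMatrix_iff Y).1 hY i
  rw [hM i] at h1
  simp only [act_bOp, hw] at h1
  rw [← smul_sum] at h1
  have h2 := congrArg (valueAtZero p) (smul_pi_injective b_ne_zero h1)
  simp only [map_sum, map_add, map_smul, valueAtZero_smul, constantCoeff_b, zero_smul, add_zero,
    valueAtZero_single] at h2
  have h3 := congrFun h2 k
  rw [Finset.sum_apply] at h3
  simp only [Pi.smul_apply, Pi.single_apply, smul_eq_mul, mul_ite, mul_one, mul_zero, sum_ite_eq,
    mem_univ, if_true] at h3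
  exact h3.symm

/-- On `E / b E` the operator `b⁻¹ a` is right multiplication by `M(0)`: the Leibniz terms `theta (x
i)` have no constant term. -/
theorem valueAtZero_of_act_aOp {M : Matrix (Fin p) (Fin p) HolA} (hE : E.IsSimplePole)
    (hM : E.HasHolMatrix M) {x y : Fin p → GevB} (h : E.act aOp x = b • y) :
    valueAtZero p y = Matrix.vecMul (valueAtZero p x) (holAtZero M) := by
  obtain ⟨Y, hY, -⟩ := E.existsUnique_hasGevMatrix hE
  have e : E.act aOp x = b • ∑ i, (x i • Y i + theta (x i) • Pi.single i (1 : GevB)) := by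
    conv_lhs => rw [eq_sum_single x]
    rw [map_sum, smul_sum]
    refine sum_congr rfl fun i _ => ?_
    rw [act_a_smul, (E.hasGevMatrix_iff Y).1 hY i, smul_add, smul_comm, mul_smul]
  rw [smul_pi_injective b_ne_zero (h.symm.trans e), ← E.gevAtZero_eq hE hM hY, map_sum]
  funext k
  simp only [map_add, valueAtZero_smul, constantCoeff_theta, zero_smul, add_zero]
  rw [Finset.sum_apply]
  rfl

/-- The inclusion of `E` in its saturation. -/
def toSaturation : (Fin p → GevB) →ₗ[ℂ] E.saturation where
  toFun x := ⟨Loc.mk x 1, Submodule.subset_span ⟨0, x, rfl⟩⟩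
  map_add' x y := Subtype.ext (by
    change Loc.mk (x + y) 1 = Loc.mk x 1 + Loc.mk y 1
    rw [Loc.mk_add, OneMemClass.coe_one, one_smul, one_smul, mul_one])
  map_smul' c x := Subtype.ext (by
    change Loc.mk (c • x) 1 = c • Loc.mk x 1
    rw [Loc.csmul, Loc.smul_mk, algebraMap_smul])

theorem toSaturation_b_smul (x : Fin p → GevB) : E.toSaturation (b • x) = b • E.toSaturation x :=
  Subtype.ext (Loc.smul_mk b x 1).symm

theorem toSaturation_injective : Function.Injective E.toSaturation := by
  intro x y h
  have h' : Loc.mk x 1 = Loc.mk y 1 := congrArg Subtype.val h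
  obtain ⟨⟨_, k, rfl⟩, hu⟩ := Loc.mk_eq.1 h'
  simp only [OneMemClass.coe_one, one_smul] at hu
  exact smul_pi_injective (pow_ne_zero k b_ne_zero) hu

theorem invBA_mk_one {x y : Fin p → GevB} (h : E.act aOp x = b • y) :
    E.invBA (Loc.mk x 1) = Loc.mk y 1 := by
  have ht : theta ((1 : Submonoid.powers b) : GevB) = 0 := by
    have := theta_algebraMap 1
    rwa [map_one] at this
  rw [invBA_mk, ht, h, Loc.mk_eq]
  refine ⟨1, ?_⟩
  simp [bS]

/-- With a simple pole `b⁻¹ a` maps `E` into itself, so saturating adds nothing. -/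
theorem toSaturation_surjective (hE : E.IsSimplePole) : Function.Surjective E.toSaturation := by
  have key : ∀ k x, ∃ y, (E.invBA ^ k) (Loc.mk x 1) = Loc.mk y 1 := by
    intro k
    induction k with
    | zero => exact fun x => ⟨x, rfl⟩
    | succ k ih =>
      intro x
      obtain ⟨y, hy⟩ := ih x
      obtain ⟨z, hz⟩ := hE y
      rw [act_bOp] at hz
      exact ⟨z, by rw [pow_succ', Module.End.mul_apply, hy, E.invBA_mk_one hz]⟩
  rintro ⟨y, hy⟩
  suffices h : ∃ x, Loc.mk x 1 = y by
    obtain ⟨x, rfl⟩ := h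
    exact ⟨x, rfl⟩
  induction hy using Submodule.span_induction with
  | mem y hy =>
    obtain ⟨k, x, rfl⟩ := hy
    obtain ⟨z, hz⟩ := key k x
    exact ⟨z, hz.symm⟩
  | zero => exact ⟨0, congrArg Subtype.val (map_zero E.toSaturation)⟩
  | add y z _ _ h1 h2 =>
    obtain ⟨y, rfl⟩ := h1
    obtain ⟨z, rfl⟩ := h2
    exact ⟨y + z, congrArg Subtype.val (map_add E.toSaturation y z)⟩
  | smul S y _ h =>
    obtain ⟨y, rfl⟩ := h
    exact ⟨S • y, (Loc.smul_mk S y 1).symm⟩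

/-- The projection of `E` on the quotient of its saturation by `b` times the saturation. -/
def toQuotient : (Fin p → GevB) →ₗ[ℂ] E.saturation ⧸ E.bSat := E.bSat.mkQ ∘ₗ E.toSaturation

theorem toQuotient_surjective (hE : E.IsSimplePole) : Function.Surjective E.toQuotient :=
  (Submodule.mkQ_surjective _).comp (E.toSaturation_surjective hE)

theorem ker_toQuotient (hE : E.IsSimplePole) :
    LinearMap.ker E.toQuotient = LinearMap.ker (valueAtZero p) := by
  ext x
  rw [LinearMap.mem_ker, LinearMap.mem_ker, valueAtZero_eq_zero_iff, toQuotient,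
    LinearMap.comp_apply, Submodule.mkQ_apply, Submodule.Quotient.mk_eq_zero]
  constructor
  · rintro ⟨z, hz⟩
    obtain ⟨y, rfl⟩ := E.toSaturation_surjective hE z
    exact ⟨y, E.toSaturation_injective (by rw [hz, toSaturation_b_smul])⟩
  · rintro ⟨y, rfl⟩
    exact ⟨E.toSaturation y, E.toSaturation_b_smul y⟩

theorem mapQ_toQuotient {x y : Fin p → GevB} (h : E.act aOp x = b • y) :
    E.bSat.mapQ E.bSat (-E.satInvBA) E.satInvBA_mem (E.toQuotient x) = -E.toQuotient y := by
  rw [toQuotient, LinearMap.comp_apply, Submodule.mkQ_apply, Submodule.mapQ_apply,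
    LinearMap.neg_apply, Submodule.Quotient.mk_neg]
  have : E.satInvBA (E.toSaturation x) = E.toSaturation y := Subtype.ext (E.invBA_mk_one h)
  rw [this]
  rfl

/-- The quotient of the saturation by `b` times the saturation, for a simple pole module. -/
def quotientEquiv (hE : E.IsSimplePole) : (E.saturation ⧸ E.bSat) ≃ₗ[ℂ] (Fin p → ℂ) :=
  (E.toQuotient.quotKerEquivOfSurjective (E.toQuotient_surjective hE)).symm ≪≫ₗ
    Submodule.quotEquivOfEq _ _ (E.ker_toQuotient hE) ≪≫ₗ
    (valueAtZero p).quotKerEquivOfSurjective valueAtZero_surjective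

theorem quotientEquiv_apply (hE : E.IsSimplePole) (x : Fin p → GevB) :
    E.quotientEquiv hE (E.toQuotient x) = valueAtZero p x := by
  rw [quotientEquiv, LinearEquiv.trans_apply, LinearEquiv.trans_apply,
    LinearMap.quotKerEquivOfSurjective_symm_apply, Submodule.quotEquivOfEq_mk,
    LinearMap.quotKerEquivOfSurjective_apply_mk]

/-- Evaluation at `0` conjugates the operator on the quotient to right multiplication by `-M(0)`;
acting on rows amounts to transposing, which does not change the minimal polynomial. -/
theorem bernstein_eq {M : Matrix (Fin p) (Fin p) HolA} (hE : E.IsSimplePole)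
    (hM : E.HasHolMatrix M) : E.bernstein = minpoly ℂ (-holAtZero M) := by
  rw [← minpoly_vecMulLinear, bernstein, ← minpoly.algEquiv_eq ((E.quotientEquiv hE).conjAlgEquiv ℂ)]
  congr 1
  refine LinearMap.ext fun v => ?_
  obtain ⟨x, rfl⟩ := valueAtZero_surjective v
  obtain ⟨y, hy⟩ := hE x
  rw [act_bOp] at hy
  rw [LinearEquiv.conjAlgEquiv_apply, LinearMap.comp_apply, LinearMap.comp_apply,
    ← E.quotientEquiv_apply hE, LinearEquiv.coe_coe, LinearEquiv.coe_coe,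
    LinearEquiv.symm_apply_apply, E.mapQ_toQuotient hy, map_neg, E.quotientEquiv_apply hE,
    E.quotientEquiv_apply hE, E.valueAtZero_of_act_aOp hE hM hy]
  exact (Matrix.vecMul_neg _ _).symm

/-- Regularity is witnessed by `E` itself, and the roots of the Bernstein polynomial are opposites
of eigenvalues of `M(0)`. -/
theorem isGeometric_of_hasHolMatrix {M : Matrix (Fin p) (Fin p) HolA} (hE : E.IsSimplePole)
    (hM : E.HasHolMatrix M) (hg : IsGeometricSystem M) : E.IsGeometric := by
  refine ⟨⟨p, E, hE, AddMonoidHom.id _, Function.injective_id, fun _ _ => rfl⟩, fun z hz => ?_⟩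
  rw [E.bernstein_eq hE hM] at hz
  have h1 := Matrix.mem_spectrum_of_isRoot_charpoly (hz.dvd (Matrix.minpoly_dvd_charpoly _))
  rw [← spectrum.neg_eq, Set.mem_neg] at h1
  obtain ⟨q, hq, e⟩ := hg _ h1
  exact ⟨-q, neg_lt_zero.2 hq, by rw [Rat.cast_neg, ← e, neg_neg]⟩

end GBM

end ABModule
end

/-! ### The theorem: existence, uniqueness and invariants. -/

theorem mainTheorem9 (p : ℕ) (hp : 1 ≤ p) (M : Matrix (Fin p) (Fin p) ABModule.HolA)
    (hM : ABModule.IsGeometricSystem M) :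
    (∃! E : ABModule.GBM p, E.IsSimplePole ∧ E.IsGeometric ∧ E.HasHolMatrix M) ∧
    ∀ E : ABModule.GBM p, E.IsSimplePole → E.IsGeometric → E.HasHolMatrix M →
      (∃! Y : Matrix (Fin p) (Fin p) ABModule.GevB, E.HasGevMatrix Y) ∧
      (∀ Y : Matrix (Fin p) (Fin p) ABModule.GevB, E.HasGevMatrix Y →
        ABModule.gevAtZero Y = ABModule.holAtZero M) ∧
      E.bernstein = minpoly ℂ (-ABModule.holAtZero M) := by
  refine ⟨?_, fun E hE _ hH =>
    ⟨E.existsUnique_hasGevMatrix hE, fun Y hY => E.gevAtZero_eq hE hH hY, E.bernstein_eq hE hH⟩⟩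
  obtain ⟨S, hS⟩ := ABModule.exists_simplePoleSystem hM
  have h1 := S.isSimplePole_toGBM
  have h2 := S.hasHolMatrix_toGBM hS
  exact ⟨S.toGBM, ⟨h1, S.toGBM.isGeometric_of_hasHolMatrix h1 h2 hM, h2⟩,
    fun E ⟨_, _, hH⟩ => E.ext_of_act_aOp S.toGBM h1 (E.act_aOp_eq S.toGBM h1 hH h2)⟩
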